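/- Let $P$ be a probability measure on $\mathbb{R}^d$ with $\int\|x\|^6\,dP<\infty$. For $x\in\mathbb{R}^d$ write $\tilde x=(x,\dots,x)\in\mathbb{R}^{kd}$ for its $k$-fold replicate. Let $\mathbf{X}_1,\dots,\mathbf{X}_n$ be i.i.d. with law $P$, with $k$-fold replicates $\tilde{\mathbf{X}}_i$, and let $\mathbf{Z}_1,\dots,\mathbf{Z}_n$ be i.i.d. Gaussian vectors in $\mathbb{R}^{kd}$ with $$\mathbb{E}\mathbf{Z}_i=\mathbf{1}_k\otimes\mathbb{E}\mathbf{X}_1,\qquad \mathrm{Var}[\mathbf{Z}_i]=\mathbf{1}_{k\times k}\otimes\mathrm{Var}[\mathbf{X}_1],$$ where $\mathbf{1}_{k\times k}$ is the all-ones matrix, and with the pairs $(\mathbf{X}_i,\mathbf{Z}_i)$, $i\le n$, independent (for instance with $\mathbf{X}$ and $\mathbf{Z}$ independent). All norms are (flattened) Euclidean norms. For a thrice differentiable $f:(\mathbb{R}^{kd})^n\to\mathbb{R}^q$ let $D_i^rf$ be the $r$-th derivative in the $i$-th block, put $\mathbf{W}_i(\mathbf{w})=(\tilde{\mathbf{X}}_1,\dots,\tilde{\mathbf{X}}_{i-1},\mathbf{w},\mathbf{Z}_{i+1},\dots,\mathbf{Z}_n)$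 and, with $\|Y\|_{L_m}=\mathbb{E}[|Y|^m]^{1/m}$, $$\alpha^r_m=\max_{i\le n}\max\Bigl\{\bigl\|\sup_{\mathbf{w}\in[0,\tilde{\mathbf{X}}_i]}\|D_i^rf(\mathbf{W}_i(\mathbf{w}))\|\bigr\|_{L_m},\ \bigl\|\sup_{\mathbf{w}\in[0,\mathbf{Z}_i]}\|D_i^rf(\mathbf{W}_i(\mathbf{w}))\|\bigr\|_{L_m}\Bigr\}\in[0,\infty].$$ For a thrice differentiable $h:\mathbb{R}^q\to\mathbb{R}$ let $\gamma^3(h)=\sup_v\|\partial^3h(v)\|$, $\eta^r(h)=\|\partial^rh(0)\|$, and $$\lambda_2(n,k)=\gamma^3(h)\bigl((\alpha^1_6)^3+3\alpha^0_6\alpha^1_6\alpha^2_6+(\alpha^0_6)^2\alpha^3_6\bigr)+\eta^2(h)\bigl(3\alpha^1_4\alpha^2_4+\alpha^0_4\alpha^3_4\bigr)+\eta^1(h)\alpha^3_2,$$ with values in $[0,\infty]$ and $0\cdot\infty=0$. Let $\mathcal{H}$ be the class of thrice differentiable $h:\mathbb{R}^q\to\mathbb{R}$ with $\eta^1(h),\eta^2(h),\gamma^3(h)\le1$,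 and $d_{\mathcal{H}}(Y,Y')=\sup_{h\in\mathcal{H}}|\mathbb{E}h(Y)-\mathbb{E}h(Y')|$. (i) If $\alpha^0_6,\alpha^1_6,\alpha^2_6<\infty$, then $$\bigl|\mathbb{E}h(f(\tilde{\mathbf{X}}_1,\dots,\tilde{\mathbf{X}}_n))-\mathbb{E}h(f(\mathbf{Z}_1,\dots,\mathbf{Z}_n))\bigr|\le nk^{3/2}\lambda_2(n,k)\Bigl(\sqrt{\mathbb{E}\|\mathbf{X}_1\|^6}+\tfrac1{k^3}\sqrt{\mathbb{E}\|\mathbf{Z}_1\|^6}\Bigr),$$ and if moreover $\gamma^3(h)<\infty$, then both expectations exist (the integrands are integrable). (If $\gamma^3(h)=\infty$, an expectation of a non-integrable variable is read as $0$.) (ii) $\tfrac1{k^3}\sqrt{\mathbb{E}\|\mathbf{Z}_1\|^6}=O(1)$ as $k\to\infty$. (iii) Fix $P$ and $q$. For every $n$ let $k=k_n\in\mathbb{N}$ (for instance constant), let $\mathbf{X}_1,\dots,\mathbf{X}_n$ and $\mathbf{Z}_1,\dots,\mathbf{Z}_n$ be as above and let $f=f_n:(\mathbb{R}^{kd})^n\to\mathbb{R}^q$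 be thrice differentiable, with $\alpha^0_6,\alpha^1_6,\alpha^2_6<\infty$ for all large $n$. If, as $n\to\infty$, $$(\alpha^1_6)^3,\ \ \alpha^0_6\alpha^1_6\alpha^2_6,\ \ (\alpha^0_6)^2\alpha^3_6,\ \ \alpha^1_4\alpha^2_4,\ \ \alpha^0_4\alpha^3_4,\ \ \alpha^3_2\ =\ o\Bigl(\frac1{nk^{3/2}}\Bigr),$$ then $$d_{\mathcal{H}}\bigl(f(\tilde{\mathbf{X}}_1,\dots,\tilde{\mathbf{X}}_n),\,f(\mathbf{Z}_1,\dots,\mathbf{Z}_n)\bigr)\to0.$$ -/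

import Mathlib

open MeasureTheory ProbabilityTheory Filter Topology
open scoped ENNReal

noncomputable section

/-- The space `ℝ^{kd}` of `k`-tuples of vectors in `ℝ^d`, with its Euclidean norm. The coordinate
`(j, l)` is the `l`-th coordinate of the `j`-th vector. -/
abbrev Block (k d : ℕ) : Type := EuclideanSpace ℝ (Fin k × Fin d)

/-- The `k`-fold replicate `(x, …, x) ∈ ℝ^{kd}` of `x ∈ ℝ^d`. -/
def replicateVec {d : ℕ} (k : ℕ) (x : EuclideanSpace ℝ (Fin d)) : Block k d :=
  WithLp.toLp 2 (fun a : Fin k × Fin d => x a.2)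

/-- The covariance matrix of a random vector in `ℝ^d` with law `P`. -/
def covMat {d : ℕ} (P : Measure (EuclideanSpace ℝ (Fin d))) : Matrix (Fin d) (Fin d) ℝ :=
  Matrix.of fun l l' => cov[fun x => x l, fun x => x l'; P]

/-- The Gaussian law on `ℝ^{kd}` with mean `1_k ⊗ m` and covariance matrix `1_{k×k} ⊗ C`, where
`m` and `C` are the mean and the covariance matrix of `P`, and `1_{k×k}` is the all-ones matrix. -/
def gaussianSurrogate {d : ℕ} (k : ℕ) (P : Measure (EuclideanSpace ℝ (Fin d))) :
    Measure (Block k d) :=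
  multivariateGaussian (replicateVec k (∫ x, x ∂P))
    (Matrix.kronecker (Matrix.of fun _ _ : Fin k => (1 : ℝ)) (covMat P))

/-- `g` is `r` times differentiable (the `r`-th derivative need not be continuous). -/
def TimesDifferentiable {E F : Type*} [NormedAddCommGroup E] [NormedSpace ℝ E]
    [NormedAddCommGroup F] [NormedSpace ℝ F] (r : ℕ) (g : E → F) : Prop :=
  ∀ m < r, Differentiable ℝ (iteratedFDeriv ℝ m g)

/-- The flattened Euclidean (Frobenius) norm of the array of all `r`-th order partial derivatives
of `g` at `x`. -/
def derivNorm {ι : Type*} [Fintype ι] [DecidableEq ι] {F : Type*} [NormedAddCommGroup F]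
    [NormedSpace ℝ F] (r : ℕ) (g : EuclideanSpace ℝ ι → F) (x : EuclideanSpace ℝ ι) : ℝ :=
  √(∑ a : Fin r → ι,
    ‖iteratedFDeriv ℝ r g x (fun s => EuclideanSpace.single (a s) (1 : ℝ))‖ ^ 2)

/-- `‖D_i^r f(v)‖`, where `D_i^r` is the `r`-th derivative in the `i`-th block. -/
def blockDerivNorm {k d n : ℕ} {F : Type*} [NormedAddCommGroup F] [NormedSpace ℝ F]
    (i : Fin n) (r : ℕ) (f : (Fin n → Block k d) → F) (v : Fin n → Block k d) : ℝ :=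
  derivNorm r (fun w : Block k d => f (Function.update v i w)) (v i)

/-- `W_i(w) = (x̃_1, …, x̃_{i-1}, w, z_{i+1}, …, z_n)`. -/
def hybrid {k d n : ℕ} (x : Fin n → EuclideanSpace ℝ (Fin d)) (z : Fin n → Block k d)
    (i : Fin n) (w : Block k d) : Fin n → Block k d :=
  fun j => if j < i then replicateVec k (x j) else if j = i then w else z j

/-- The noise stability term `α^r_m` (for `m ≥ 1`), as an element of `[0, ∞]`. -/
def noiseStability {k d n : ℕ} {F : Type*} [NormedAddCommGroup F] [NormedSpace ℝ F]
    {Ω : Type*} [MeasurableSpace Ω] (μ : Measure Ω)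
    (X : Fin n → Ω → EuclideanSpace ℝ (Fin d)) (Z : Fin n → Ω → Block k d)
    (f : (Fin n → Block k d) → F) (r m : ℕ) : ℝ≥0∞ :=
  ⨆ i : Fin n, max
    ((∫⁻ ω, (⨆ w ∈ segment ℝ 0 (replicateVec k (X i ω)), ENNReal.ofReal
      (blockDerivNorm i r f (hybrid (fun j => X j ω) (fun j => Z j ω) i w))) ^ m ∂μ)
        ^ (1 / m : ℝ))
    ((∫⁻ ω, (⨆ w ∈ segment ℝ 0 (Z i ω), ENNReal.ofReal
      (blockDerivNorm i r f (hybrid (fun j => X j ω) (fun j => Z j ω) i w))) ^ m ∂μ)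
        ^ (1 / m : ℝ))

/-- `γ^3(h) = sup_v ‖∂^3 h(v)‖ ∈ [0, ∞]`. -/
def gammaThree {q : ℕ} (h : EuclideanSpace ℝ (Fin q) → ℝ) : ℝ≥0∞ :=
  ⨆ v, ENNReal.ofReal (derivNorm 3 h v)

/-- `η^r(h) = ‖∂^r h(0)‖`. -/
def etaNorm {q : ℕ} (r : ℕ) (h : EuclideanSpace ℝ (Fin q) → ℝ) : ℝ≥0∞ :=
  ENNReal.ofReal (derivNorm r h 0)

/-- The mixed smoothness term `λ_2` formed from the noise stability terms `α r m = α^r_m`. -/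
def lambdaTwo {q : ℕ} (h : EuclideanSpace ℝ (Fin q) → ℝ) (α : ℕ → ℕ → ℝ≥0∞) : ℝ≥0∞ :=
  gammaThree h * (α 1 6 ^ 3 + 3 * α 0 6 * α 1 6 * α 2 6 + α 0 6 ^ 2 * α 3 6)
    + etaNorm 2 h * (3 * α 1 4 * α 2 4 + α 0 4 * α 3 4)
    + etaNorm 1 h * α 3 2

/-- The class of test functions: thrice differentiable with `η^1, η^2, γ^3 ≤ 1`. -/
def testClass (q : ℕ) : Set (EuclideanSpace ℝ (Fin q) → ℝ) :=
  {h | TimesDifferentiable 3 h ∧ etaNorm 1 h ≤ 1 ∧ etaNorm 2 h ≤ 1 ∧ gammaThree h ≤ 1}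

/-- `d_H(Y, Y') = sup_h |E h(Y) - E h(Y')|`, the supremum over the class of test functions. -/
def dH {q : ℕ} {Ω : Type*} [MeasurableSpace Ω] (μ : Measure Ω)
    (Y Y' : Ω → EuclideanSpace ℝ (Fin q)) : ℝ≥0∞ :=
  ⨆ h ∈ testClass q, ENNReal.ofReal |∫ ω, h (Y ω) ∂μ - ∫ ω, h (Y' ω) ∂μ|

/-- `X_1, …, X_n` are i.i.d. with law `P`, `Z_1, …, Z_n` are i.i.d. with law `gaussianSurrogate k P`,
and the pairs `(X_i, Z_i)` are independent; in particular `X` and `Z` may be independent. -/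
structure IsSampleWithSurrogate {k d n : ℕ} (P : Measure (EuclideanSpace ℝ (Fin d)))
    {Ω : Type*} [MeasurableSpace Ω] (μ : Measure Ω)
    (X : Fin n → Ω → EuclideanSpace ℝ (Fin d)) (Z : Fin n → Ω → Block k d) : Prop where
  hasLaw_data : ∀ i, HasLaw (X i) P μ
  hasLaw_gaussian : ∀ i, HasLaw (Z i) (gaussianSurrogate k P) μ
  indep : iIndepFun (fun i ω => (X i ω, Z i ω)) μ

/-- Each of the six products of noise stability terms that make up `λ_2` is `o(1 / (n k^{3/2}))`
as `n → ∞`, where `k = k n` and `α n r m` is `α^r_m` at sample size `n`. -/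
def SmoothnessLambdaTwo (k : ℕ → ℕ) (α : ℕ → ℕ → ℕ → ℝ≥0∞) : Prop :=
  let small : (ℕ → ℝ≥0∞) → Prop := fun a =>
    Tendsto (fun n : ℕ => ENNReal.ofReal ((n : ℝ) * (k n : ℝ) ^ (3 / 2 : ℝ)) * a n) atTop (𝓝 0)
  small (fun n => α n 1 6 ^ 3) ∧
  small (fun n => α n 0 6 * α n 1 6 * α n 2 6) ∧
  small (fun n => α n 0 6 ^ 2 * α n 3 6) ∧
  small (fun n => α n 1 4 * α n 2 4) ∧
  small (fun n => α n 0 4 * α n 3 4) ∧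
  small (fun n => α n 3 2)

end

/-! This is the Lindeberg replacement method. The Gaussian vectors are exchanged for replicated data
one block at a time, and both configurations in the `i`-th exchange are compared with the base point
`W_i(0)`, whose `i`-th block is zero. The base point is independent of the pair `(X_i, Z_i)`
(`indepFun_basePoint`). The replicate of `X_i` and the surrogate `Z_i` have the same first and
second moments, so the first and second order Taylor terms of `h ∘ f` at the base point have equal
expectations (`integral_taylorPart_eq`) and cancel.

What remains is the third order remainder along the segment from the base point
(`enorm_pathRemainder_le`). The third derivative of `h ∘ c` along a path `c` is `∂³h(c', c', c') + 3
∂²h(c', c'') + ∂h(c''')`. Integrating `∂³h` outward from the origin gives `‖∂²h(y)‖ ≤ η² + γ³ ‖y‖`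
and `‖∂h(y)‖ ≤ η¹ + η² ‖y‖ + γ³ ‖y‖²`, and substituting these produces exactly the monomials of
`λ_2`. Each monomial has total derivative order three, so a factor `‖w‖³` comes out, and Hölder's
inequality separates the noise stability terms from `√E‖w‖⁶` (`lintegral_smoothnessBound_mul_le`).

For the replicate, `√E‖w‖⁶ = k^{3/2} √E‖X‖⁶`. For the surrogate, `E‖Z‖⁶ ≤ 15 k³ E‖X‖⁶`, so its root
is at most `4` times as large. With Taylor's factor `1/6` the two remainders add up to at most `(1 +
4)/6 ≤ 1` times `λ_2 k^{3/2} √E‖X‖⁶`: the data moment alone pays for both, and the Gaussian summand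
in the stated bound is slack.

Two difficulties are technical. The third derivative of `f` need not be continuous, so the suprema
in the noise stability terms are not evidently measurable, while Hölder's inequality needs
measurable factors. They are replaced from below by countable suprema, with the Lipschitz constant
of the second derivative in place of the supremum of the third; only monotonicity of the lower
integral is then used. And if `γ³(h) = ∞`, the right side is infinite except in degenerate cases, in
each of which the two sides are compared almost surely. -/

noncomputable section

open scoped NNReal

/-! ### Operator bounds by Frobenius norms -/

section Multilinear

variable {ι : Type*} [Fintype ι] [DecidableEq ι] {F : Type*} [NormedAddCommGroup F]
  [NormedSpace ℝ F]

/-- A multilinear map on a Euclidean space is bounded by the Frobenius norm of its array of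
coefficients. -/
lemma norm_multilinear_le_frobenius {r : ℕ}
    (M : ContinuousMultilinearMap ℝ (fun _ : Fin r => EuclideanSpace ℝ ι) F)
    (v : Fin r → EuclideanSpace ℝ ι) :
    ‖M v‖ ≤ √(∑ a : Fin r → ι, ‖M (fun s => EuclideanSpace.single (a s) (1 : ℝ))‖ ^ 2)
      * ∏ s, ‖v s‖ := by
  have hv : v = fun s => ∑ a, v s a • EuclideanSpace.single a (1 : ℝ) := by
    funext s
    ext b
    simp [Finset.sum_apply, Pi.single_apply]
  have h1 : M v = ∑ a : Fin r → ι, (∏ s, v s (a s)) •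
      M (fun s => EuclideanSpace.single (a s) (1 : ℝ)) := by
    conv_lhs => rw [hv]
    rw [M.map_sum]
    refine Finset.sum_congr rfl fun a _ => ?_
    rw [M.map_smul_univ]
  -- The product of the norms is the Euclidean norm of the tensor product of the vectors, so the
  -- claim is Cauchy–Schwarz for tensors.
  have h2 : ∏ s, ‖v s‖ = √(∑ a : Fin r → ι, (∏ s, v s (a s)) ^ 2) := by
    rw [eq_comm, Real.sqrt_eq_iff_mul_self_eq (by positivity) (by positivity), ← pow_two,
      ← Finset.prod_pow]
    simp_rw [EuclideanSpace.real_norm_sq_eq, Finset.prod_univ_sum, Finset.prod_pow]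
    simp
  rw [h1, h2, mul_comm, ← Real.sqrt_mul (by positivity)]
  refine (norm_sum_le _ _).trans (Real.le_sqrt_of_sq_le ?_)
  simp_rw [norm_smul]
  refine (Finset.sum_mul_sq_le_sq_mul_sq _ _ _).trans (le_of_eq ?_)
  simp_rw [Real.norm_eq_abs, sq_abs]

lemma norm_iteratedFDeriv_apply_le_derivNorm (r : ℕ) (g : EuclideanSpace ℝ ι → F)
    (x : EuclideanSpace ℝ ι) (v : Fin r → EuclideanSpace ℝ ι) :
    ‖iteratedFDeriv ℝ r g x v‖ ≤ derivNorm r g x * ∏ s, ‖v s‖ :=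
  norm_multilinear_le_frobenius _ v

lemma derivNorm_nonneg (r : ℕ) (g : EuclideanSpace ℝ ι → F) (x : EuclideanSpace ℝ ι) :
    0 ≤ derivNorm r g x := Real.sqrt_nonneg _

end Multilinear

/-! ### Derivatives along paths and Taylor's inequality -/

section Path

variable {E F : Type*} [NormedAddCommGroup E] [NormedSpace ℝ E] [NormedAddCommGroup F]
  [NormedSpace ℝ F]

/-- The Leibniz rule for the `r`-th derivative along a path, evaluated at moving vectors. -/
lemma hasDerivAt_iteratedFDeriv_comp {r : ℕ} {h : E → F} {c : ℝ → E} {c' : E} {t : ℝ}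
    (hd : DifferentiableAt ℝ (iteratedFDeriv ℝ r h) (c t)) (hc : HasDerivAt c c' t)
    {m : Fin r → ℝ → E} {m' : Fin r → E} (hm : ∀ s, HasDerivAt (m s) (m' s) t) :
    HasDerivAt (fun t => iteratedFDeriv ℝ r h (c t) (fun s => m s t))
      (iteratedFDeriv ℝ (r + 1) h (c t) (Fin.cons c' fun s => m s t)
        + ∑ s, iteratedFDeriv ℝ r h (c t) (Function.update (fun s => m s t) s (m' s))) t := by
  have h1 : HasFDerivAt (fun t => iteratedFDeriv ℝ r h (c t)) _ t :=
    hd.hasFDerivAt.comp t hc.hasFDerivAt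
  have h2 := (h1.continuousMultilinearMap_apply fun s => (hm s).hasFDerivAt).hasDerivAt
  convert! h2 using 1
  simp [iteratedFDeriv_succ_apply_left]

lemma TimesDifferentiable.contDiff_two {g : E → F} (hg : TimesDifferentiable 3 g) :
    ContDiff ℝ 2 g := by
  refine contDiff_of_differentiable_iteratedFDeriv (n := 2) fun m hm => hg m ?_
  have : m ≤ 2 := by exact_mod_cast hm
  omega

lemma hasDerivAt_iteratedFDeriv_line {r : ℕ} {g : E → F}
    (hd : Differentiable ℝ (iteratedFDeriv ℝ r g)) (p v : E) (t : ℝ) :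
    HasDerivAt (fun t => iteratedFDeriv ℝ r g (p + t • v) (fun _ => v))
      (iteratedFDeriv ℝ (r + 1) g (p + t • v) (fun _ => v)) t := by
  have hc : HasDerivAt (fun t : ℝ => p + t • v) v t := by
    simpa using ((hasDerivAt_id t).smul_const v).const_add p
  have := hasDerivAt_iteratedFDeriv_comp (m := fun _ _ => v) (m' := fun _ => 0) (hd _) hc
    (fun s => hasDerivAt_const t v)
  convert this using 1
  -- The direction is constant, so every Leibniz term that differentiates an argument vanishes.
  rw [Finset.sum_eq_zero, add_zero]
  · congr 1
    funext s
    refine Fin.cases rfl (fun _ => rfl) s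
  · intro s _
    exact (iteratedFDeriv ℝ r g (p + t • v)).map_update_zero _ _

lemma norm_one_le_of_norm_deriv_le {v v' : ℝ → F} {C : ℝ} (hv : ∀ t, HasDerivAt v (v' t) t)
    (hC : ∀ t ∈ Set.Icc (0 : ℝ) 1, ‖v' t‖ ≤ C) : ‖v 1‖ ≤ ‖v 0‖ + C := by
  have h := norm_image_sub_le_of_norm_deriv_le_segment_01'
    (fun x _ => (hv x).hasDerivWithinAt) (fun x hx => hC x ⟨hx.1, hx.2.le⟩)
  have := norm_sub_norm_le (v 1) (v 0)
  linarith

/-- Taylor's inequality of order two on the unit interval. -/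
lemma norm_taylor_two_remainder_le {u u₁ u₂ u₃ : ℝ → F} {C : ℝ}
    (h0 : ∀ t, HasDerivAt u (u₁ t) t) (h1 : ∀ t, HasDerivAt u₁ (u₂ t) t)
    (h2 : ∀ t, HasDerivAt u₂ (u₃ t) t) (hC : ∀ t ∈ Set.Icc (0 : ℝ) 1, ‖u₃ t‖ ≤ C) :
    ‖u 1 - u 0 - u₁ 0 - (1 / 2 : ℝ) • u₂ 0‖ ≤ C / 6 := by
  -- One integration of a bound `D t^n`, done by comparison because `u₃` is not assumed integrable.
  -- Used with `n = 0, 1, 2` it turns `C` into `C`, `C/2`, `C/6`.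
  have key : ∀ (n : ℕ) (D : ℝ) (v v' : ℝ → F), (∀ t, HasDerivAt v (v' t) t) → v 0 = 0 →
      (∀ t ∈ Set.Icc (0 : ℝ) 1, ‖v' t‖ ≤ D * t ^ n) →
      ∀ t ∈ Set.Icc (0 : ℝ) 1, ‖v t‖ ≤ D / (n + 1) * t ^ (n + 1) := by
    intro n D v v' hv hv0 hb
    refine image_norm_le_of_norm_deriv_right_le_deriv_boundary
      (f' := v') (B' := fun t => D * t ^ n)
      (fun x _ => (hv x).continuousAt.continuousWithinAt) (fun x _ => (hv x).hasDerivWithinAt)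
      (by simp [hv0]) (fun x => ?_) (fun x hx => hb x ⟨hx.1, hx.2.le⟩)
    have := ((hasDerivAt_pow (n + 1) x).const_mul (D / (n + 1)))
    refine this.congr_deriv ?_
    have : (n : ℝ) + 1 ≠ 0 := by positivity
    push_cast
    field_simp
  have e2 := key 0 C (fun t => u₂ t - u₂ 0) u₃ (fun t => (h2 t).sub_const _) (by simp)
    (fun t ht => by simpa using hC t ht)
  have e1 := key 1 C (fun t => u₁ t - u₁ 0 - t • u₂ 0) (fun t => u₂ t - u₂ 0)
    (fun t => by
      simpa [Pi.sub_def] using ((h1 t).sub_const (u₁ 0)).sub ((hasDerivAt_id t).smul_const (u₂ 0)))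
    (by simp) (fun t ht => by simpa using e2 t ht)
  have e0 := key 2 (C / 2) (fun t => u t - u 0 - t • u₁ 0 - (t ^ 2 / 2) • u₂ 0)
    (fun t => u₁ t - u₁ 0 - t • u₂ 0)
    (fun t => by
      have := (((h0 t).sub_const (u 0)).sub ((hasDerivAt_id t).smul_const (u₁ 0))).sub
        (((hasDerivAt_pow 2 t).div_const 2).smul_const (u₂ 0))
      simpa [Pi.sub_def] using this)
    (by simp) (fun t ht => by have := e1 t ht; norm_num at this ⊢; exact this)
  have := e0 1 (by simp)
  norm_num at this ⊢
  refine this.trans (by linarith)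

end Path

/-! ### Chain rule and growth of the test function -/

section TestFunction

variable {q : ℕ} {h : EuclideanSpace ℝ (Fin q) → ℝ}

/-- With the next two lemmas this allows three differentiations of `h ∘ c`. There the arguments `a`,
`b` move with `t`, since they will be derivatives of the path `c` itself. -/
lemma TimesDifferentiable.hasDerivAt_comp (hh : TimesDifferentiable 3 h)
    {c : ℝ → EuclideanSpace ℝ (Fin q)} {c' : EuclideanSpace ℝ (Fin q)} {t : ℝ}
    (hc : HasDerivAt c c' t) :
    HasDerivAt (fun t => h (c t)) (iteratedFDeriv ℝ 1 h (c t) ![c']) t := by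
  have := hasDerivAt_iteratedFDeriv_comp (hh 0 (by norm_num) (c t)) hc (m := ![]) (m' := ![])
    (by simp)
  simpa using this

lemma TimesDifferentiable.hasDerivAt_one (hh : TimesDifferentiable 3 h)
    {c a : ℝ → EuclideanSpace ℝ (Fin q)} {c' a' : EuclideanSpace ℝ (Fin q)} {t : ℝ}
    (hc : HasDerivAt c c' t) (ha : HasDerivAt a a' t) :
    HasDerivAt (fun t => iteratedFDeriv ℝ 1 h (c t) ![a t])
      (iteratedFDeriv ℝ 2 h (c t) ![c', a t] + iteratedFDeriv ℝ 1 h (c t) ![a']) t := by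
  have := hasDerivAt_iteratedFDeriv_comp (hh 1 (by norm_num) (c t)) hc (m := ![a]) (m' := ![a'])
    (by simpa using ha)
  have e : ∀ t, (fun s => (![a] : Fin 1 → ℝ → _) s t) = ![a t] := fun t => by
    funext s; fin_cases s; rfl
  simp only [e] at this
  refine this.congr_deriv (congrArg₂ _ rfl ?_)
  simp only [Finset.univ_unique, Fin.default_eq_zero, Finset.sum_singleton]
  congr 1
  funext s; fin_cases s; simp

lemma TimesDifferentiable.hasDerivAt_two (hh : TimesDifferentiable 3 h)
    {c a b : ℝ → EuclideanSpace ℝ (Fin q)} {c' a' b' : EuclideanSpace ℝ (Fin q)} {t : ℝ}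
    (hc : HasDerivAt c c' t) (ha : HasDerivAt a a' t) (hb : HasDerivAt b b' t) :
    HasDerivAt (fun t => iteratedFDeriv ℝ 2 h (c t) ![a t, b t])
      (iteratedFDeriv ℝ 3 h (c t) ![c', a t, b t] + (iteratedFDeriv ℝ 2 h (c t) ![a', b t]
        + iteratedFDeriv ℝ 2 h (c t) ![a t, b'])) t := by
  have := hasDerivAt_iteratedFDeriv_comp (hh 2 (by norm_num) (c t)) hc (m := ![a, b])
    (m' := ![a', b']) (by simpa [Fin.forall_fin_two] using ⟨ha, hb⟩)
  have e : ∀ t, (fun s => (![a, b] : Fin 2 → ℝ → _) s t) = ![a t, b t] := fun t => by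
    funext s; fin_cases s <;> rfl
  simp only [e] at this
  refine this.congr_deriv (congrArg₂ _ rfl ?_)
  rw [Fin.sum_univ_two]
  congr 2
  · funext s; fin_cases s <;> simp
  · funext s; fin_cases s <;> simp

lemma hasDerivAt_smul_vec (y : EuclideanSpace ℝ (Fin q)) (t : ℝ) :
    HasDerivAt (fun t : ℝ => t • y) y t := by
  simpa using (hasDerivAt_id t).smul_const y

variable {G : ℝ}

lemma abs_iteratedFDeriv_three_le (hG : ∀ v, derivNorm 3 h v ≤ G)
    (y a b c : EuclideanSpace ℝ (Fin q)) :
    |iteratedFDeriv ℝ 3 h y ![a, b, c]| ≤ G * (‖a‖ * ‖b‖ * ‖c‖) := by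
  have := norm_iteratedFDeriv_apply_le_derivNorm 3 h y ![a, b, c]
  simp only [Fin.prod_univ_three, Real.norm_eq_abs] at this
  exact this.trans (mul_le_mul_of_nonneg_right (hG y) (by positivity))

/-- The mean value inequality on the ray from `0` to `y`, where the derivative is a third derivative
of `h` in the directions `y, a, b`. The two lemmas below descend to `∂h` and `h` in the same way. -/
lemma abs_iteratedFDeriv_two_le (hh : TimesDifferentiable 3 h) (hG : ∀ v, derivNorm 3 h v ≤ G)
    (y a b : EuclideanSpace ℝ (Fin q)) :
    |iteratedFDeriv ℝ 2 h y ![a, b]| ≤ (derivNorm 2 h 0 + G * ‖y‖) * (‖a‖ * ‖b‖) := by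
  have h0 := norm_iteratedFDeriv_apply_le_derivNorm 2 h 0 ![a, b]
  simp only [Fin.prod_univ_two] at h0
  have h1 := norm_one_le_of_norm_deriv_le (C := G * (‖y‖ * ‖a‖ * ‖b‖))
    (fun t => hh.hasDerivAt_two (hasDerivAt_smul_vec y t) (hasDerivAt_const t a)
      (hasDerivAt_const t b)) fun t _ => by
      have e1 : iteratedFDeriv ℝ 2 h (t • y) ![0, b] = 0 :=
        (iteratedFDeriv ℝ 2 h (t • y)).map_coord_zero 0 rfl
      have e2 : iteratedFDeriv ℝ 2 h (t • y) ![a, 0] = 0 :=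
        (iteratedFDeriv ℝ 2 h (t • y)).map_coord_zero 1 rfl
      rw [e1, e2, add_zero, add_zero]
      exact abs_iteratedFDeriv_three_le hG _ _ _ _
  simp only [one_smul, zero_smul, Real.norm_eq_abs] at h1 h0
  refine h1.trans ((add_le_add_left h0 _).trans (le_of_eq ?_))
  simp
  ring

lemma abs_iteratedFDeriv_one_le (hh : TimesDifferentiable 3 h) (hG : ∀ v, derivNorm 3 h v ≤ G)
    (y a : EuclideanSpace ℝ (Fin q)) :
    |iteratedFDeriv ℝ 1 h y ![a]|
      ≤ (derivNorm 1 h 0 + derivNorm 2 h 0 * ‖y‖ + G * ‖y‖ ^ 2) * ‖a‖ := by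
  have hG0 : 0 ≤ G := (derivNorm_nonneg _ _ _).trans (hG 0)
  have h0 := norm_iteratedFDeriv_apply_le_derivNorm 1 h 0 ![a]
  simp only [Fin.prod_univ_one] at h0
  have h1 := norm_one_le_of_norm_deriv_le
    (C := (derivNorm 2 h 0 + G * ‖y‖) * (‖y‖ * ‖a‖))
    (fun t => hh.hasDerivAt_one (hasDerivAt_smul_vec y t) (hasDerivAt_const t a)) fun t ht => by
      have e1 : iteratedFDeriv ℝ 1 h (t • y) ![0] = 0 :=
        (iteratedFDeriv ℝ 1 h (t • y)).map_coord_zero 0 rfl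
      rw [e1, add_zero]
      refine (abs_iteratedFDeriv_two_le hh hG _ _ _).trans ?_
      gcongr
      rw [norm_smul, Real.norm_of_nonneg ht.1]
      exact mul_le_of_le_one_left (norm_nonneg _) ht.2
  simp only [one_smul, zero_smul, Real.norm_eq_abs] at h1 h0
  refine h1.trans ((add_le_add_left h0 _).trans (le_of_eq ?_))
  simp
  ring

lemma abs_testFunction_le (hh : TimesDifferentiable 3 h) (hG : ∀ v, derivNorm 3 h v ≤ G)
    (y : EuclideanSpace ℝ (Fin q)) :
    |h y| ≤ |h 0| + (derivNorm 1 h 0 + derivNorm 2 h 0 * ‖y‖ + G * ‖y‖ ^ 2) * ‖y‖ := by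
  have hG0 : 0 ≤ G := (derivNorm_nonneg _ _ _).trans (hG 0)
  have hN := derivNorm_nonneg 2 h 0
  have h1 := norm_one_le_of_norm_deriv_le
    (C := (derivNorm 1 h 0 + derivNorm 2 h 0 * ‖y‖ + G * ‖y‖ ^ 2) * ‖y‖)
    (fun t => hh.hasDerivAt_comp (hasDerivAt_smul_vec y t)) fun t ht => by
      refine (abs_iteratedFDeriv_one_le hh hG _ _).trans ?_
      have : ‖t • y‖ ≤ ‖y‖ := by
        rw [norm_smul, Real.norm_of_nonneg ht.1]
        exact mul_le_of_le_one_left (norm_nonneg _) ht.2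
      gcongr
  simpa using h1

end TestFunction

/-! ### Countable forms of the sup and Lipschitz norms of a path -/

section PathNorms

variable {F : Type*} [NormedAddCommGroup F] [NormedSpace ℝ F]

/-- A sequence of points that is dense in the unit interval. -/
def unitSeq (n : ℕ) : ℝ := (TopologicalSpace.denseSeq (Set.Icc (0 : ℝ) 1) n : ℝ)

lemma unitSeq_mem (n : ℕ) : unitSeq n ∈ Set.Icc (0 : ℝ) 1 :=
  (TopologicalSpace.denseSeq (Set.Icc (0 : ℝ) 1) n).2

/-- The supremum norm on the unit interval, as a countable supremum. -/
def supEnorm (v : ℝ → F) : ℝ≥0∞ := ⨆ n, ‖v (unitSeq n)‖ₑ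

/-- The Lipschitz constant on the unit interval, as a countable supremum. -/
def lipEnorm (v : ℝ → F) : ℝ≥0∞ :=
  ⨆ a : ℕ × ℕ, ‖v (unitSeq a.1) - v (unitSeq a.2)‖ₑ / ‖unitSeq a.1 - unitSeq a.2‖ₑ

omit [NormedSpace ℝ F] in
lemma enorm_le_supEnorm {v : ℝ → F} (hv : Continuous v) {t : ℝ} (ht : t ∈ Set.Icc (0 : ℝ) 1) :
    ‖v t‖ₑ ≤ supEnorm v := by
  have hcl : IsClosed {s : Set.Icc (0 : ℝ) 1 | ‖v s‖ₑ ≤ supEnorm v} :=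
    isClosed_le (by fun_prop) continuous_const
  have := (TopologicalSpace.denseRange_denseSeq (Set.Icc (0 : ℝ) 1)).closure_eq ▸
    hcl.closure_subset_iff.2 (by
      rintro _ ⟨n, rfl⟩
      exact le_iSup (fun n => ‖v (unitSeq n)‖ₑ) n)
  exact this (Set.mem_univ (⟨t, ht⟩ : Set.Icc (0 : ℝ) 1))

omit [NormedSpace ℝ F] in
lemma supEnorm_le {v : ℝ → F} {C : ℝ≥0∞} (h : ∀ t ∈ Set.Icc (0 : ℝ) 1, ‖v t‖ₑ ≤ C) :
    supEnorm v ≤ C := iSup_le fun n => h _ (unitSeq_mem n)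

lemma lipEnorm_le {v v' : ℝ → F} {C : ℝ≥0∞} (hv : ∀ t, HasDerivAt v (v' t) t)
    (h : ∀ t ∈ Set.Icc (0 : ℝ) 1, ‖v' t‖ₑ ≤ C) : lipEnorm v ≤ C := by
  refine iSup_le fun a => ENNReal.div_le_of_le_mul ?_
  induction C with
  -- The product `∞ * 0` is `0`, so coinciding points have to be treated separately.
  | top =>
    rcases eq_or_ne (unitSeq a.1) (unitSeq a.2) with hn | hn
    · simp [hn]
    · rw [ENNReal.top_mul (by simpa [sub_eq_zero] using hn)]
      exact le_top
  | coe C =>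
    have := (convex_Icc (0 : ℝ) 1).norm_image_sub_le_of_norm_hasDerivWithin_le (C := C)
      (fun x _ => (hv x).hasDerivWithinAt)
      (fun x hx => by have := h x hx; rw [enorm_eq_nnnorm] at this; exact_mod_cast this)
      (unitSeq_mem a.2) (unitSeq_mem a.1)
    rw [enorm_eq_nnnorm, enorm_eq_nnnorm]
    exact_mod_cast this

omit [NormedSpace ℝ F] in
lemma enorm_sub_le_lipEnorm {v : ℝ → F} (hv : Continuous v) {s t : ℝ}
    (hs : s ∈ Set.Icc (0 : ℝ) 1) (ht : t ∈ Set.Icc (0 : ℝ) 1) :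
    ‖v s - v t‖ₑ ≤ lipEnorm v * ‖s - t‖ₑ := by
  -- Multiplication by `∞` is not continuous on `[0, ∞]`; the density argument below needs a finite
  -- constant.
  rcases eq_or_ne (lipEnorm v) ∞ with htop | htop
  · rcases eq_or_ne s t with hn | hn
    · simp [hn]
    · rw [htop, ENNReal.top_mul (by simpa [sub_eq_zero] using hn)]
      exact le_top
  have hcl : IsClosed {x : Set.Icc (0 : ℝ) 1 × Set.Icc (0 : ℝ) 1 |
      ‖v x.1 - v x.2‖ₑ ≤ lipEnorm v * ‖(x.1 : ℝ) - x.2‖ₑ} :=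
    isClosed_le (by fun_prop) ((ENNReal.continuous_const_mul htop).comp (by fun_prop))
  have hd := (TopologicalSpace.denseRange_denseSeq (Set.Icc (0 : ℝ) 1)).prodMap
    (TopologicalSpace.denseRange_denseSeq (Set.Icc (0 : ℝ) 1))
  have := hd.closure_eq ▸ hcl.closure_subset_iff.2 (by
      rintro _ ⟨a, rfl⟩
      have := le_iSup (fun a : ℕ × ℕ =>
        ‖v (unitSeq a.1) - v (unitSeq a.2)‖ₑ / ‖unitSeq a.1 - unitSeq a.2‖ₑ) a
      change ‖v (unitSeq a.1) - v (unitSeq a.2)‖ₑ ≤ lipEnorm v * ‖unitSeq a.1 - unitSeq a.2‖ₑ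
      rcases eq_or_ne (unitSeq a.1) (unitSeq a.2) with hn | hn
      · simp [hn]
      · exact (ENNReal.div_le_iff (by simpa [sub_eq_zero] using hn) (by simp)).1 this)
  exact this (Set.mem_univ ((⟨s, hs⟩, ⟨t, ht⟩) : Set.Icc (0 : ℝ) 1 × Set.Icc (0 : ℝ) 1))

/-- The derivative is a limit of slopes taken inside the interval, which is possible at the
endpoints too. Hence the Lipschitz constant can replace the supremum of a derivative that may be
discontinuous. -/
lemma enorm_deriv_le_lipEnorm {v : ℝ → F} {v' : F} {t : ℝ} (hc : Continuous v)
    (hv : HasDerivAt v v' t) (ht : t ∈ Set.Icc (0 : ℝ) 1) : ‖v'‖ₑ ≤ lipEnorm v := by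
  have h1 := hasDerivWithinAt_iff_tendsto_slope.1 (hv.hasDerivWithinAt (s := Set.Icc 0 1))
  have : (𝓝[Set.Icc (0 : ℝ) 1 \ {t}] t).NeBot := by
    have := (uniqueDiffOn_Icc (zero_lt_one (α := ℝ))) t ht
    exact accPt_principal_iff_nhdsWithin.1 this.accPt
  refine le_of_tendsto ((continuous_enorm.tendsto _).comp h1) ?_
  filter_upwards [self_mem_nhdsWithin] with s hs
  have hst : s - t ≠ 0 := sub_ne_zero.2 hs.2
  have := enorm_sub_le_lipEnorm hc hs.1 ht
  simp only [Function.comp, slope_def_module, enorm_smul, enorm_inv hst]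
  rw [mul_comm, ← div_eq_mul_inv]
  exact ENNReal.div_le_of_le_mul this

end PathNorms

/-! ### The third order Taylor remainder of `h` along a path -/

section Remainder

variable {q : ℕ} {h : EuclideanSpace ℝ (Fin q) → ℝ}

/-- The second order Taylor remainder at `0` of `h` along a path with values in `ℝ^q`, evaluated
at `1`. The arguments `a₁`, `a₂` are the derivatives of the path at `0`. -/
def pathRemainder (h : EuclideanSpace ℝ (Fin q) → ℝ) (y a a₁ a₂ : EuclideanSpace ℝ (Fin q)) : ℝ :=
  h y - h a - iteratedFDeriv ℝ 1 h a ![a₁]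
    - (1 / 2) * (iteratedFDeriv ℝ 2 h a ![a₁, a₁] + iteratedFDeriv ℝ 1 h a ![a₂])

/-- The third order smoothness of `h` along a path whose derivatives of order `r` are bounded by
`b r`. -/
def smoothnessBound (γ η₂ η₁ : ℝ≥0∞) (b : ℕ → ℝ≥0∞) : ℝ≥0∞ :=
  γ * (b 1 ^ 3 + 3 * b 0 * b 1 * b 2 + b 0 ^ 2 * b 3) + η₂ * (3 * b 1 * b 2 + b 0 * b 3)
    + η₁ * b 3

lemma smoothnessBound_mono {γ η₂ η₁ : ℝ≥0∞} {b b' : ℕ → ℝ≥0∞} (hb : ∀ r < 4, b r ≤ b' r) :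
    smoothnessBound γ η₂ η₁ b ≤ smoothnessBound γ η₂ η₁ b' := by
  unfold smoothnessBound
  gcongr <;> apply hb <;> norm_num

/-- The sup norms of a path and of its first two derivatives, and the Lipschitz constant of the
second one. -/
def pathBound {F : Type*} [NormedAddCommGroup F] (c c₁ c₂ : ℝ → F) : ℕ → ℝ≥0∞
  | 0 => supEnorm c
  | 1 => supEnorm c₁
  | 2 => supEnorm c₂
  | _ => lipEnorm c₂

/-- Taylor's inequality for `h ∘ c`, with its third derivative bounded through the growth of `∂h`
and `∂²h`; the division by `6` is Taylor's constant. -/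
lemma enorm_pathRemainder_le (hh : TimesDifferentiable 3 h) {G : ℝ}
    (hG : ∀ v, derivNorm 3 h v ≤ G) {c c₁ c₂ c₃ : ℝ → EuclideanSpace ℝ (Fin q)}
    (h0 : ∀ t, HasDerivAt c (c₁ t) t) (h1 : ∀ t, HasDerivAt c₁ (c₂ t) t)
    (h2 : ∀ t, HasDerivAt c₂ (c₃ t) t) :
    ‖pathRemainder h (c 1) (c 0) (c₁ 0) (c₂ 0)‖ₑ
      ≤ smoothnessBound (ENNReal.ofReal G) (etaNorm 2 h) (etaNorm 1 h) (pathBound c c₁ c₂) / 6 := by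
  have hG0 : 0 ≤ G := (derivNorm_nonneg _ _ _).trans (hG 0)
  set u₁ : ℝ → ℝ := fun t => iteratedFDeriv ℝ 1 h (c t) ![c₁ t] with hu₁
  set u₂ : ℝ → ℝ := fun t => iteratedFDeriv ℝ 2 h (c t) ![c₁ t, c₁ t]
    + iteratedFDeriv ℝ 1 h (c t) ![c₂ t] with hu₂
  set u₃ : ℝ → ℝ := fun t => iteratedFDeriv ℝ 3 h (c t) ![c₁ t, c₁ t, c₁ t]
      + (iteratedFDeriv ℝ 2 h (c t) ![c₂ t, c₁ t] + iteratedFDeriv ℝ 2 h (c t) ![c₁ t, c₂ t])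
    + (iteratedFDeriv ℝ 2 h (c t) ![c₁ t, c₂ t] + iteratedFDeriv ℝ 1 h (c t) ![c₃ t]) with hu₃
  have d0 : ∀ t, HasDerivAt (fun t => h (c t)) (u₁ t) t := fun t => hh.hasDerivAt_comp (h0 t)
  have d1 : ∀ t, HasDerivAt u₁ (u₂ t) t := fun t => hh.hasDerivAt_one (h0 t) (h1 t)
  have d2 : ∀ t, HasDerivAt u₂ (u₃ t) t := fun t =>
    (hh.hasDerivAt_two (h0 t) (h1 t) (h1 t)).add (hh.hasDerivAt_one (h0 t) (h2 t))
  set S := smoothnessBound (ENNReal.ofReal G) (etaNorm 2 h) (etaNorm 1 h) (pathBound c c₁ c₂)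
    with hS
  have hbound : ∀ t ∈ Set.Icc (0 : ℝ) 1, ‖u₃ t‖ₑ ≤ S := by
    intro t ht
    have e0 : ‖c t‖ₑ ≤ supEnorm c :=
      enorm_le_supEnorm (continuous_iff_continuousAt.2 fun t => (h0 t).continuousAt) ht
    have e1 : ‖c₁ t‖ₑ ≤ supEnorm c₁ :=
      enorm_le_supEnorm (continuous_iff_continuousAt.2 fun t => (h1 t).continuousAt) ht
    have hc2 : Continuous c₂ := continuous_iff_continuousAt.2 fun t => (h2 t).continuousAt
    have e2 : ‖c₂ t‖ₑ ≤ supEnorm c₂ := enorm_le_supEnorm hc2 ht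
    have e3 : ‖c₃ t‖ₑ ≤ lipEnorm c₂ := enorm_deriv_le_lipEnorm hc2 (h2 t) ht
    -- The three `∂²h` terms account for the coefficient `3`; the mixed terms in `‖c t‖` come from
    -- the growth bounds.
    have hreal : ‖u₃ t‖ ≤ G * (‖c₁ t‖ ^ 3 + 3 * ‖c t‖ * ‖c₁ t‖ * ‖c₂ t‖ + ‖c t‖ ^ 2 * ‖c₃ t‖)
        + derivNorm 2 h 0 * (3 * ‖c₁ t‖ * ‖c₂ t‖ + ‖c t‖ * ‖c₃ t‖)
        + derivNorm 1 h 0 * ‖c₃ t‖ := by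
      have a3 := abs_iteratedFDeriv_three_le hG (c t) (c₁ t) (c₁ t) (c₁ t)
      have a2 := abs_iteratedFDeriv_two_le hh hG (c t) (c₁ t) (c₂ t)
      have a2' := abs_iteratedFDeriv_two_le hh hG (c t) (c₂ t) (c₁ t)
      have a1 := abs_iteratedFDeriv_one_le hh hG (c t) (c₃ t)
      rw [Real.norm_eq_abs, hu₃]
      refine (abs_add_le _ _).trans ((add_le_add ((abs_add_le _ _).trans
        (add_le_add a3 ((abs_add_le _ _).trans (add_le_add a2' a2))))
        ((abs_add_le _ _).trans (add_le_add a2 a1))).trans (le_of_eq (by ring)))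
    have henn : ‖u₃ t‖ₑ ≤ smoothnessBound (ENNReal.ofReal G) (etaNorm 2 h) (etaNorm 1 h)
        (fun r => match r with
          | 0 => ‖c t‖ₑ
          | 1 => ‖c₁ t‖ₑ
          | 2 => ‖c₂ t‖ₑ
          | _ => ‖c₃ t‖ₑ) := by
      lift G to ℝ≥0 using hG0
      obtain ⟨H₁, hH₁⟩ : ∃ H : ℝ≥0, (H : ℝ) = derivNorm 1 h 0 := ⟨⟨_, derivNorm_nonneg _ _ _⟩, rfl⟩
      obtain ⟨H₂, hH₂⟩ : ∃ H : ℝ≥0, (H : ℝ) = derivNorm 2 h 0 := ⟨⟨_, derivNorm_nonneg _ _ _⟩, rfl⟩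
      simp only [smoothnessBound, etaNorm, ← hH₁, ← hH₂, ENNReal.ofReal_coe_nnreal,
        enorm_eq_nnnorm] at hreal ⊢
      exact_mod_cast hreal
    refine henn.trans (smoothnessBound_mono fun r hr => ?_)
    interval_cases r
    · exact e0
    · exact e1
    · exact e2
    · exact e3
  rcases eq_or_ne S ∞ with htop | htop
  · rw [htop, ENNReal.top_div_of_ne_top (by norm_num)]
    exact le_top
  have hT := norm_taylor_two_remainder_le d0 d1 d2 (C := S.toReal) fun t ht => by
    have := ENNReal.toReal_mono htop (hbound t ht)
    simpa using this
  have : ‖pathRemainder h (c 1) (c 0) (c₁ 0) (c₂ 0)‖ ≤ (S / 6).toReal := by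
    rw [ENNReal.toReal_div]
    simpa [pathRemainder, hu₁, hu₂] using hT
  rw [← ofReal_norm]
  exact ENNReal.ofReal_le_of_le_toReal this

end Remainder

/-! ### Hölder's inequality for the monomials of `λ_2` -/

section Hoelder

variable {Ω : Type*} [MeasurableSpace Ω] {μ : Measure Ω}

/-- `N³` takes the exponent `2` and becomes a sixth moment to the power `1/2`. The other half is
shared equally by one, two or three factors, whence the orders `2`, `4`, `6` in this lemma and the
next two. -/
lemma lintegral_mul_pow_three_le {a N : Ω → ℝ≥0∞} (ha : AEMeasurable a μ) (hN : AEMeasurable N μ) :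
    ∫⁻ ω, a ω * N ω ^ 3 ∂μ
      ≤ (∫⁻ ω, a ω ^ 2 ∂μ) ^ (1 / (2 : ℕ) : ℝ) * (∫⁻ ω, N ω ^ 6 ∂μ) ^ (1 / 2 : ℝ) := by
  have := ENNReal.lintegral_prod_norm_pow_le (μ := μ) Finset.univ
    (f := ![fun ω => a ω ^ 2, fun ω => N ω ^ 6]) (p := ![1 / (2 : ℕ), 1 / 2])
    (by simpa [Fin.forall_fin_two] using ⟨ha.pow_const 2, hN.pow_const 6⟩)
    (by rw [Fin.sum_univ_two]; norm_num)
    (by simp [Fin.forall_fin_two])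
  simp only [Fin.prod_univ_two, Matrix.cons_val_zero, Matrix.cons_val_one] at this
  refine le_trans (le_of_eq ?_) this
  congr with ω
  simp only [← ENNReal.rpow_natCast, ← ENNReal.rpow_mul]
  norm_num

lemma lintegral_mul_mul_pow_three_le {a b N : Ω → ℝ≥0∞} (ha : AEMeasurable a μ)
    (hb : AEMeasurable b μ) (hN : AEMeasurable N μ) :
    ∫⁻ ω, a ω * b ω * N ω ^ 3 ∂μ
      ≤ (∫⁻ ω, a ω ^ 4 ∂μ) ^ (1 / (4 : ℕ) : ℝ) * (∫⁻ ω, b ω ^ 4 ∂μ) ^ (1 / (4 : ℕ) : ℝ)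
        * (∫⁻ ω, N ω ^ 6 ∂μ) ^ (1 / 2 : ℝ) := by
  have := ENNReal.lintegral_prod_norm_pow_le (μ := μ) Finset.univ
    (f := ![fun ω => a ω ^ 4, fun ω => b ω ^ 4, fun ω => N ω ^ 6])
    (p := ![1 / (4 : ℕ), 1 / (4 : ℕ), 1 / 2])
    (by simpa [Fin.forall_fin_succ] using ⟨ha.pow_const 4, hb.pow_const 4, hN.pow_const 6⟩)
    (by rw [Fin.sum_univ_three]; simp; norm_num)
    (by simp [Fin.forall_fin_succ])
  simp only [Fin.prod_univ_three, Matrix.cons_val_zero, Matrix.cons_val_one,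
    Matrix.cons_val_two, Matrix.tail_cons, Matrix.head_cons] at this
  refine le_trans (le_of_eq ?_) this
  congr with ω
  simp only [← ENNReal.rpow_natCast, ← ENNReal.rpow_mul]
  norm_num

lemma lintegral_mul_mul_mul_pow_three_le {a b c N : Ω → ℝ≥0∞} (ha : AEMeasurable a μ)
    (hb : AEMeasurable b μ) (hc : AEMeasurable c μ) (hN : AEMeasurable N μ) :
    ∫⁻ ω, a ω * b ω * c ω * N ω ^ 3 ∂μ
      ≤ (∫⁻ ω, a ω ^ 6 ∂μ) ^ (1 / (6 : ℕ) : ℝ) * (∫⁻ ω, b ω ^ 6 ∂μ) ^ (1 / (6 : ℕ) : ℝ)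
        * (∫⁻ ω, c ω ^ 6 ∂μ) ^ (1 / (6 : ℕ) : ℝ) * (∫⁻ ω, N ω ^ 6 ∂μ) ^ (1 / 2 : ℝ) := by
  have := ENNReal.lintegral_prod_norm_pow_le (μ := μ) Finset.univ
    (f := ![fun ω => a ω ^ 6, fun ω => b ω ^ 6, fun ω => c ω ^ 6, fun ω => N ω ^ 6])
    (p := ![1 / (6 : ℕ), 1 / (6 : ℕ), 1 / (6 : ℕ), 1 / 2])
    (by simpa [Fin.forall_fin_succ] using
      ⟨ha.pow_const 6, hb.pow_const 6, hc.pow_const 6, hN.pow_const 6⟩)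
    (by rw [Fin.sum_univ_four]; simp; norm_num)
    (by simp [Fin.forall_fin_succ])
  simp only [Fin.prod_univ_four, Matrix.cons_val_zero, Matrix.cons_val_one,
    Matrix.cons_val] at this
  refine le_trans (le_of_eq ?_) this
  congr with ω
  simp only [← ENNReal.rpow_natCast, ← ENNReal.rpow_mul]
  norm_num

/-- Hölder's inequality for the third order smoothness along a random path. -/
lemma lintegral_smoothnessBound_mul_le {γ η₂ η₁ : ℝ≥0∞} {c : ℕ → Ω → ℝ≥0∞} {N : Ω → ℝ≥0∞}
    (hc : ∀ r, AEMeasurable (c r) μ) (hN : AEMeasurable N μ) {α : ℕ → ℕ → ℝ≥0∞}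
    (hα : ∀ r < 4, ∀ m : ℕ, (∫⁻ ω, c r ω ^ m ∂μ) ^ (1 / m : ℝ) ≤ α r m) :
    ∫⁻ ω, smoothnessBound γ η₂ η₁ (fun r => c r ω) * N ω ^ 3 ∂μ
      ≤ (γ * (α 1 6 ^ 3 + 3 * α 0 6 * α 1 6 * α 2 6 + α 0 6 ^ 2 * α 3 6)
          + η₂ * (3 * α 1 4 * α 2 4 + α 0 4 * α 3 4) + η₁ * α 3 2)
        * (∫⁻ ω, N ω ^ 6 ∂μ) ^ (1 / 2 : ℝ) := by
  have hsplit : ∀ ω, smoothnessBound γ η₂ η₁ (fun r => c r ω) * N ω ^ 3 =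
      γ * (c 1 ω * c 1 ω * c 1 ω * N ω ^ 3) + 3 * γ * (c 0 ω * c 1 ω * c 2 ω * N ω ^ 3)
        + γ * (c 0 ω * c 0 ω * c 3 ω * N ω ^ 3) + 3 * η₂ * (c 1 ω * c 2 ω * N ω ^ 3)
        + η₂ * (c 0 ω * c 3 ω * N ω ^ 3) + η₁ * (c 3 ω * N ω ^ 3) := by
    intro ω; unfold smoothnessBound; ring
  have hc0 := hc 0; have hc1 := hc 1; have hc2 := hc 2; have hc3 := hc 3
  simp_rw [hsplit]
  rw [lintegral_add_left' (by fun_prop), lintegral_add_left' (by fun_prop),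
    lintegral_add_left' (by fun_prop), lintegral_add_left' (by fun_prop),
    lintegral_add_left' (by fun_prop), lintegral_const_mul'' _ (by fun_prop),
    lintegral_const_mul'' _ (by fun_prop), lintegral_const_mul'' _ (by fun_prop),
    lintegral_const_mul'' _ (by fun_prop), lintegral_const_mul'' _ (by fun_prop),
    lintegral_const_mul'' _ (by fun_prop)]
  set I := (∫⁻ ω, N ω ^ 6 ∂μ) ^ (1 / 2 : ℝ)
  have t1 := lintegral_mul_mul_mul_pow_three_le hc1 hc1 hc1 hN
  have t2 := lintegral_mul_mul_mul_pow_three_le hc0 hc1 hc2 hN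
  have t3 := lintegral_mul_mul_mul_pow_three_le hc0 hc0 hc3 hN
  have t4 := lintegral_mul_mul_pow_three_le hc1 hc2 hN
  have t5 := lintegral_mul_mul_pow_three_le hc0 hc3 hN
  have t6 := lintegral_mul_pow_three_le hc3 hN
  have e1 : _ ≤ α 1 6 * α 1 6 * α 1 6 * I := t1.trans (by gcongr <;> exact hα _ (by norm_num) _)
  have e2 : _ ≤ α 0 6 * α 1 6 * α 2 6 * I := t2.trans (by gcongr <;> exact hα _ (by norm_num) _)
  have e3 : _ ≤ α 0 6 * α 0 6 * α 3 6 * I := t3.trans (by gcongr <;> exact hα _ (by norm_num) _)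
  have e4 : _ ≤ α 1 4 * α 2 4 * I := t4.trans (by gcongr <;> exact hα _ (by norm_num) _)
  have e5 : _ ≤ α 0 4 * α 3 4 * I := t5.trans (by gcongr <;> exact hα _ (by norm_num) _)
  have e6 : _ ≤ α 3 2 * I := t6.trans (by gcongr; exact hα _ (by norm_num) _)
  refine (add_le_add (add_le_add (add_le_add (add_le_add (add_le_add
    (mul_le_mul_right e1 γ) (mul_le_mul_right e2 (3 * γ))) (mul_le_mul_right e3 γ))
    (mul_le_mul_right e4 (3 * η₂))) (mul_le_mul_right e5 η₂))
    (mul_le_mul_right e6 η₁)).trans (le_of_eq (by ring))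

end Hoelder

/-! ### Derivatives under affine substitution -/

section Affine

variable {E B F : Type*} [NormedAddCommGroup E] [NormedSpace ℝ E] [NormedAddCommGroup B]
  [NormedSpace ℝ B] [NormedAddCommGroup F] [NormedSpace ℝ F] {f : E → F}

lemma TimesDifferentiable.iteratedFDeriv_comp_affine (hf : TimesDifferentiable 3 f) (p : E)
    (A : B →L[ℝ] E) {r : ℕ} (hr : r < 3) (x : B) :
    iteratedFDeriv ℝ r (fun w => f (p + A w)) x
      = (iteratedFDeriv ℝ r f (p + A x)).compContinuousLinearMap fun _ => A := by
  have h1 : ContDiff ℝ 2 (fun y => f (p + y)) := hf.contDiff_two.comp (by fun_prop)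
  have h2 := A.iteratedFDeriv_comp_right h1 x (i := r) (by exact_mod_cast Nat.le_of_lt_succ hr)
  rw [iteratedFDeriv_comp_add_left] at h2
  exact h2

lemma TimesDifferentiable.comp_affine (hf : TimesDifferentiable 3 f) (p : E) (A : B →L[ℝ] E) :
    TimesDifferentiable 3 (fun w => f (p + A w)) := by
  intro r hr
  have : iteratedFDeriv ℝ r (fun w => f (p + A w)) =
      (fun M => ContinuousMultilinearMap.compContinuousLinearMapL (F := F)
        (fun _ : Fin r => A) M) ∘ fun x => iteratedFDeriv ℝ r f (p + A x) := by
    funext x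
    exact hf.iteratedFDeriv_comp_affine p A hr x
  rw [this]
  exact (ContinuousLinearMap.differentiable _).comp ((hf r hr).comp (by fun_prop))

/-- Below order three this is the chain rule for `C²` functions. At order three, where continuity is
lost, both sides are derivatives in `t` of the same second order expression, and derivatives are
unique. -/
lemma TimesDifferentiable.iteratedFDeriv_line (hf : TimesDifferentiable 3 f) (p : E)
    (A : B →L[ℝ] E) {r : ℕ} (hr : r ≤ 3) (w : B) (t : ℝ) :
    iteratedFDeriv ℝ r (fun w => f (p + A w)) (t • w) (fun _ => w)
      = iteratedFDeriv ℝ r f (p + t • A w) (fun _ => A w) := by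
  rcases hr.lt_or_eq with hr | rfl
  · rw [hf.iteratedFDeriv_comp_affine p A hr]
    simp
  · have h1 := hasDerivAt_iteratedFDeriv_line (hf.comp_affine p A 2 (by norm_num)) 0 w t
    have h2 := hasDerivAt_iteratedFDeriv_line (hf 2 (by norm_num)) p (A w) t
    simp only [zero_add] at h1
    refine h1.unique (h2.congr_of_eventuallyEq (Eventually.of_forall fun s => ?_))
    simp only [hf.iteratedFDeriv_comp_affine p A (show 2 < 3 by norm_num)]
    simp

end Affine

/-! ### Block derivatives along the segments from the base point -/

section Hybrid

variable {k d n : ℕ} {F : Type*} [NormedAddCommGroup F] [NormedSpace ℝ F]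

/-- The inclusion of the `i`-th block. -/
def blockIncl (k d : ℕ) {n : ℕ} (i : Fin n) : Block k d →L[ℝ] (Fin n → Block k d) :=
  ContinuousLinearMap.single ℝ (fun _ : Fin n => Block k d) i

lemma hybrid_eq_add (x : Fin n → EuclideanSpace ℝ (Fin d)) (z : Fin n → Block k d) (i : Fin n)
    (w : Block k d) : hybrid x z i w = hybrid x z i 0 + blockIncl k d i w := by
  funext j
  rcases eq_or_ne j i with rfl | hj
  · simp [hybrid, blockIncl]
  · simp [hybrid, blockIncl, hj]

lemma blockDerivNorm_hybrid (x : Fin n → EuclideanSpace ℝ (Fin d)) (z : Fin n → Block k d)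
    (i : Fin n) (r : ℕ) (f : (Fin n → Block k d) → F) (w : Block k d) :
    blockDerivNorm i r f (hybrid x z i w)
      = derivNorm r (fun w => f (hybrid x z i 0 + blockIncl k d i w)) w := by
  have h1 : ∀ w', Function.update (hybrid x z i w) i w' = hybrid x z i w' := by
    intro w'
    funext j
    rcases eq_or_ne j i with rfl | hj
    · simp [hybrid]
    · simp [hybrid, hj]
  have h2 : hybrid x z i w i = w := by simp [hybrid]
  simp only [blockDerivNorm, h1, h2, ← hybrid_eq_add]

/-- The `r`-th derivative of `f` along the segment from `p` to `p + v`. -/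
def pathDeriv {E : Type*} [NormedAddCommGroup E] [NormedSpace ℝ E] (f : E → F) (p v : E) (r : ℕ)
    (t : ℝ) : F :=
  iteratedFDeriv ℝ r f (p + t • v) (fun _ => v)

/-- The bounds for the path `t ↦ f (p + t v)` and its derivatives. -/
def lineBound {E : Type*} [NormedAddCommGroup E] [NormedSpace ℝ E] (f : E → F) (p v : E) :
    ℕ → ℝ≥0∞ :=
  pathBound (pathDeriv f p v 0) (pathDeriv f p v 1) (pathDeriv f p v 2)

/-- The supremum over the segment `[0, w]` of the norm of the `r`-th block derivative. -/
def segmentSup (f : (Fin n → Block k d) → F) (x : Fin n → EuclideanSpace ℝ (Fin d))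
    (z : Fin n → Block k d) (i : Fin n) (r : ℕ) (w : Block k d) : ℝ≥0∞ :=
  ⨆ w' ∈ segment ℝ 0 w, ENNReal.ofReal (blockDerivNorm i r f (hybrid x z i w'))

variable {f : (Fin n → Block k d) → F}

lemma enorm_iteratedFDeriv_le_segmentSup (x : Fin n → EuclideanSpace ℝ (Fin d))
    (z : Fin n → Block k d) (i : Fin n) (r : ℕ) (w : Block k d) {t : ℝ}
    (ht : t ∈ Set.Icc (0 : ℝ) 1) (m : Fin r → Block k d) :
    ‖iteratedFDeriv ℝ r (fun w => f (hybrid x z i 0 + blockIncl k d i w)) (t • w) m‖ₑ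
      ≤ segmentSup f x z i r w * ∏ s, ‖m s‖ₑ := by
  have hmem : t • w ∈ segment ℝ 0 w := by
    rw [segment_eq_image]
    exact ⟨t, ht, by simp⟩
  have h1 := norm_iteratedFDeriv_apply_le_derivNorm r
    (fun w => f (hybrid x z i 0 + blockIncl k d i w)) (t • w) m
  rw [← blockDerivNorm_hybrid] at h1
  rw [← ofReal_norm]
  refine (ENNReal.ofReal_le_ofReal h1).trans ?_
  rw [ENNReal.ofReal_mul (show 0 ≤ blockDerivNorm i r f _ from Real.sqrt_nonneg _),
    ENNReal.ofReal_prod_of_nonneg (by simp)]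
  simp only [ofReal_norm]
  gcongr
  exact le_iSup₂ (f := fun w' _ => ENNReal.ofReal (blockDerivNorm i r f (hybrid x z i w'))) _ hmem

lemma TimesDifferentiable.enorm_pathDeriv_le (hf : TimesDifferentiable 3 f)
    (x : Fin n → EuclideanSpace ℝ (Fin d)) (z : Fin n → Block k d) (i : Fin n) {r : ℕ}
    (hr : r ≤ 3) (w : Block k d) {t : ℝ} (ht : t ∈ Set.Icc (0 : ℝ) 1) :
    ‖pathDeriv f (hybrid x z i 0) (blockIncl k d i w) r t‖ₑ
      ≤ segmentSup f x z i r w * ‖w‖ₑ ^ r := by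
  have := enorm_iteratedFDeriv_le_segmentSup (f := f) x z i r w ht (fun _ => w)
  rw [hf.iteratedFDeriv_line _ _ hr] at this
  simpa [pathDeriv] using this

lemma TimesDifferentiable.hasDerivAt_pathDeriv {E : Type*} [NormedAddCommGroup E]
    [NormedSpace ℝ E] {f : E → F} (hf : TimesDifferentiable 3 f) (p v : E) {r : ℕ} (hr : r < 3)
    (t : ℝ) : HasDerivAt (pathDeriv f p v r) (pathDeriv f p v (r + 1) t) t :=
  hasDerivAt_iteratedFDeriv_line (hf r hr) p v t

/-- This compares the measurable path bounds with the suprema in the noise stability terms. At order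
three it is the mean value inequality for the second derivative. -/
lemma TimesDifferentiable.lineBound_le (hf : TimesDifferentiable 3 f)
    (x : Fin n → EuclideanSpace ℝ (Fin d)) (z : Fin n → Block k d) (i : Fin n) {r : ℕ}
    (hr : r ≤ 3) (w : Block k d) :
    lineBound f (hybrid x z i 0) (blockIncl k d i w) r ≤ segmentSup f x z i r w * ‖w‖ₑ ^ r := by
  interval_cases r
  · exact supEnorm_le fun t ht => hf.enorm_pathDeriv_le x z i (by norm_num) w ht
  · exact supEnorm_le fun t ht => hf.enorm_pathDeriv_le x z i (by norm_num) w ht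
  · exact supEnorm_le fun t ht => hf.enorm_pathDeriv_le x z i (by norm_num) w ht
  · exact lipEnorm_le (fun t => hf.hasDerivAt_pathDeriv _ _ (by norm_num) t)
      fun t ht => hf.enorm_pathDeriv_le x z i (by norm_num) w ht

end Hybrid

/-! ### Cubic growth bounds for integrability -/

section Growth

variable {q : ℕ} {h : EuclideanSpace ℝ (Fin q) → ℝ} {G : ℝ}

lemma derivNorm_three_le_toReal_gammaThree (hγ : gammaThree h ≠ ∞) (v : EuclideanSpace ℝ (Fin q)) :
    derivNorm 3 h v ≤ (gammaThree h).toReal :=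
  (ENNReal.ofReal_le_iff_le_toReal hγ).1
    (le_iSup (fun v => ENNReal.ofReal (derivNorm 3 h v)) v)

/-- Deliberately crude: once one `K ≥ 1` dominates every argument, all relevant quantities are at
most a constant times `K³`, and integrability only needs `K` in `L³`. -/
lemma abs_iteratedFDeriv_one_le_pow (hh : TimesDifferentiable 3 h) (hG : ∀ v, derivNorm 3 h v ≤ G)
    (y a : EuclideanSpace ℝ (Fin q)) {K : ℝ} (hK : 1 ≤ K) (hy : ‖y‖ ≤ K) (ha : ‖a‖ ≤ K) :
    |iteratedFDeriv ℝ 1 h y ![a]| ≤ (derivNorm 1 h 0 + derivNorm 2 h 0 + G) * K ^ 3 := by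
  have hG0 : 0 ≤ G := (derivNorm_nonneg _ _ _).trans (hG 0)
  have h1 := derivNorm_nonneg 1 h 0
  have h2 := derivNorm_nonneg 2 h 0
  have hK2 : K ≤ K ^ 2 := by nlinarith
  calc _ ≤ _ := abs_iteratedFDeriv_one_le hh hG y a
    _ ≤ (derivNorm 1 h 0 * K ^ 2 + derivNorm 2 h 0 * K ^ 2 + G * K ^ 2) * K := by
        gcongr
        · nlinarith
        · exact hy.trans hK2
    _ = _ := by ring

lemma abs_iteratedFDeriv_two_le_pow (hh : TimesDifferentiable 3 h) (hG : ∀ v, derivNorm 3 h v ≤ G)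
    (y a b : EuclideanSpace ℝ (Fin q)) {K : ℝ} (hK : 1 ≤ K) (hy : ‖y‖ ≤ K) (ha : ‖a‖ ≤ K)
    (hb : ‖b‖ ≤ K) :
    |iteratedFDeriv ℝ 2 h y ![a, b]| ≤ (derivNorm 2 h 0 + G) * K ^ 3 := by
  have hG0 : 0 ≤ G := (derivNorm_nonneg _ _ _).trans (hG 0)
  have h2 := derivNorm_nonneg 2 h 0
  calc _ ≤ _ := abs_iteratedFDeriv_two_le hh hG y a b
    _ ≤ (derivNorm 2 h 0 * K + G * K) * (K * K) := by
        gcongr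
        nlinarith
    _ = _ := by ring

lemma abs_testFunction_le_pow (hh : TimesDifferentiable 3 h) (hG : ∀ v, derivNorm 3 h v ≤ G)
    (y : EuclideanSpace ℝ (Fin q)) {K : ℝ} (hK : 1 ≤ K) (hy : ‖y‖ ≤ K) :
    |h y| ≤ (|h 0| + derivNorm 1 h 0 + derivNorm 2 h 0 + G) * K ^ 3 := by
  have hG0 : 0 ≤ G := (derivNorm_nonneg _ _ _).trans (hG 0)
  have h1 := derivNorm_nonneg 1 h 0
  have h2 := derivNorm_nonneg 2 h 0
  have hK2 : K ≤ K ^ 2 := by nlinarith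
  calc _ ≤ _ := abs_testFunction_le hh hG y
    _ ≤ |h 0| * K ^ 3 + (derivNorm 1 h 0 * K ^ 2 + derivNorm 2 h 0 * K ^ 2 + G * K ^ 2) * K := by
        gcongr
        · exact le_mul_of_one_le_right (abs_nonneg _) (one_le_pow₀ hK)
        · nlinarith
        · exact hy.trans hK2
    _ = _ := by ring

end Growth

/-! ### The Taylor polynomial of `h ∘ f` in coordinates -/

section Expansion

variable {q : ℕ} {E : Type*} [NormedAddCommGroup E] [NormedSpace ℝ E]
  {h : EuclideanSpace ℝ (Fin q) → ℝ} {f : E → EuclideanSpace ℝ (Fin q)}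

/-- The first and second order terms of the expansion of `h ∘ f` at `p` in the direction `v`. -/
def taylorPart (h : EuclideanSpace ℝ (Fin q) → ℝ) (f : E → EuclideanSpace ℝ (Fin q)) (p v : E) :
    ℝ :=
  iteratedFDeriv ℝ 1 h (f p) ![iteratedFDeriv ℝ 1 f p ![v]]
    + (1 / 2) * (iteratedFDeriv ℝ 2 h (f p) ![iteratedFDeriv ℝ 1 f p ![v],
        iteratedFDeriv ℝ 1 f p ![v]]
      + iteratedFDeriv ℝ 1 h (f p) ![iteratedFDeriv ℝ 2 f p ![v, v]])

lemma pathDeriv_zero (f : E → EuclideanSpace ℝ (Fin q)) (p v : E) (t : ℝ) :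
    pathDeriv f p v 0 t = f (p + t • v) := by
  simp [pathDeriv]

lemma pathRemainder_eq (h : EuclideanSpace ℝ (Fin q) → ℝ) (f : E → EuclideanSpace ℝ (Fin q))
    (p v : E) :
    pathRemainder h (pathDeriv f p v 0 1) (pathDeriv f p v 0 0) (pathDeriv f p v 1 0)
      (pathDeriv f p v 2 0) = h (f (p + v)) - h (f p) - taylorPart h f p v := by
  have e1 : (fun _ : Fin 1 => v) = ![v] := by funext s; fin_cases s; rfl
  have e2 : (fun _ : Fin 2 => v) = ![v, v] := by funext s; fin_cases s <;> rfl
  rw [pathDeriv_zero, pathDeriv_zero]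
  simp only [pathDeriv, pathRemainder, taylorPart, zero_smul, add_zero, one_smul, e1, e2]
  ring

/-- The coefficients of the first order term. -/
def linCoeff (h : EuclideanSpace ℝ (Fin q) → ℝ) (f : E → EuclideanSpace ℝ (Fin q)) (a p : E) : ℝ :=
  iteratedFDeriv ℝ 1 h (f p) ![iteratedFDeriv ℝ 1 f p ![a]]

/-- The coefficients of the second order term. -/
def quadCoeff (h : EuclideanSpace ℝ (Fin q) → ℝ) (f : E → EuclideanSpace ℝ (Fin q)) (a b p : E) :
    ℝ :=
  iteratedFDeriv ℝ 2 h (f p) ![iteratedFDeriv ℝ 1 f p ![a], iteratedFDeriv ℝ 1 f p ![b]]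
    + iteratedFDeriv ℝ 1 h (f p) ![iteratedFDeriv ℝ 2 f p ![a, b]]

/-- Coordinates separate the coefficients, which depend on the base point, from the direction, so
that independence can be applied to each product. -/
lemma taylorPart_sum {ι : Type*} [Fintype ι] (h : EuclideanSpace ℝ (Fin q) → ℝ)
    (f : E → EuclideanSpace ℝ (Fin q)) (p : E) (c : ι → ℝ) (e : ι → E) :
    taylorPart h f p (∑ a, c a • e a) = ∑ a, linCoeff h f (e a) p * c a
      + (1 / 2) * ∑ a, ∑ b, quadCoeff h f (e a) (e b) p * (c a * c b) := by
  simp only [taylorPart, linCoeff, quadCoeff, iteratedFDeriv_one_apply, iteratedFDeriv_two_apply,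
    Matrix.cons_val_zero, Matrix.cons_val_one, map_sum, map_smul, smul_eq_mul,
    FunLike.coe_sum, Finset.sum_apply, FunLike.coe_smul, Pi.smul_apply,
    Finset.smul_sum, Finset.mul_sum, add_mul, mul_add, Finset.sum_add_distrib]
  congr 1
  · exact Finset.sum_congr rfl fun a _ => mul_comm _ _
  congr 1
  · rw [Finset.sum_comm]
    exact Finset.sum_congr rfl fun a _ => Finset.sum_congr rfl fun b _ => by ring
  · rw [Finset.sum_comm]
    exact Finset.sum_congr rfl fun a _ => Finset.sum_congr rfl fun b _ => by ring

lemma TimesDifferentiable.continuous_iteratedFDeriv {F : Type*} [NormedAddCommGroup F]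
    [NormedSpace ℝ F] {g : E → F} (hg : TimesDifferentiable 3 g) {r : ℕ} (hr : r < 3) :
    Continuous (iteratedFDeriv ℝ r g) := (hg r hr).continuous

lemma TimesDifferentiable.continuous {F : Type*} [NormedAddCommGroup F]
    [NormedSpace ℝ F] {g : E → F} (hg : TimesDifferentiable 3 g) : Continuous g :=
  hg.contDiff_two.continuous

lemma TimesDifferentiable.continuous_eval {F T : Type*} [NormedAddCommGroup F]
    [NormedSpace ℝ F] [TopologicalSpace T] {g : E → F} (hg : TimesDifferentiable 3 g) {r : ℕ}
    (hr : r < 3) {c : T → E} {m : T → Fin r → E} (hc : Continuous c) (hm : Continuous m) :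
    Continuous fun t => iteratedFDeriv ℝ r g (c t) (m t) :=
  ContinuousEval.continuous_eval.comp
    (((hg.continuous_iteratedFDeriv hr).comp hc).prodMk hm)

lemma continuous_linCoeff (hh : TimesDifferentiable 3 h) (hf : TimesDifferentiable 3 f) (a : E) :
    Continuous (linCoeff h f a) := by
  have h1 : Continuous fun p => iteratedFDeriv ℝ 1 f p ![a] :=
    hf.continuous_eval (by norm_num) continuous_id continuous_const
  exact hh.continuous_eval (by norm_num) hf.continuous (by fun_prop)

lemma continuous_quadCoeff (hh : TimesDifferentiable 3 h) (hf : TimesDifferentiable 3 f)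
    (a b : E) : Continuous (quadCoeff h f a b) := by
  have h1 : ∀ a, Continuous fun p => iteratedFDeriv ℝ 1 f p ![a] := fun a =>
    hf.continuous_eval (by norm_num) continuous_id continuous_const
  have h2 : Continuous fun p => iteratedFDeriv ℝ 2 f p ![a, b] :=
    hf.continuous_eval (by norm_num) continuous_id continuous_const
  have := h1 a; have := h1 b
  exact (hh.continuous_eval (by norm_num) hf.continuous (by fun_prop)).add
    (hh.continuous_eval (by norm_num) hf.continuous (by fun_prop))

end Expansion

/-! ### Measurability of the path bounds -/

section Measurability

variable {E F : Type*} [NormedAddCommGroup E] [NormedSpace ℝ E] [NormedAddCommGroup F]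
  [NormedSpace ℝ F] [MeasurableSpace E] [BorelSpace E] [SecondCountableTopology E]

/-- Only derivatives of order at most two occur. At fixed times these are jointly continuous in the
point and the direction, and the suprema are countable. -/
lemma measurable_lineBound {f : E → F} (hf : TimesDifferentiable 3 f) (r : ℕ) :
    Measurable fun y : E × E => lineBound f y.1 y.2 r := by
  have hc : ∀ r < 3, ∀ t, Continuous fun y : E × E => pathDeriv f y.1 y.2 r t := fun r hr t =>
    hf.continuous_eval hr (by fun_prop) (by fun_prop)
  have h3 : ∀ r < 3, Measurable fun y : E × E => supEnorm (pathDeriv f y.1 y.2 r) := fun r hr =>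
    .iSup fun n => (continuous_enorm.comp (hc r hr _)).measurable
  have h4 : Measurable fun y : E × E => lipEnorm (pathDeriv f y.1 y.2 2) :=
    .iSup fun a => (continuous_enorm.comp
      ((hc 2 (by norm_num) _).sub (hc 2 (by norm_num) _))).measurable.div_const _
  match r with
  | 0 => exact h3 0 (by norm_num)
  | 1 => exact h3 1 (by norm_num)
  | 2 => exact h3 2 (by norm_num)
  | _ + 3 => exact h4

end Measurability

/-! ### Remainder and Taylor terms for one random block -/

section Step

variable {k d n q : ℕ} {Ω : Type*} [MeasurableSpace Ω] {μ : Measure Ω}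
  {X : Fin n → Ω → EuclideanSpace ℝ (Fin d)} {Z : Fin n → Ω → Block k d}
  {f : (Fin n → Block k d) → EuclideanSpace ℝ (Fin q)} {h : EuclideanSpace ℝ (Fin q) → ℝ}
  {i : Fin n} {w : Ω → Block k d}

/-- The random point `W_i(0)`. -/
def basePoint (X : Fin n → Ω → EuclideanSpace ℝ (Fin d)) (Z : Fin n → Ω → Block k d) (i : Fin n)
    (ω : Ω) : Fin n → Block k d :=
  hybrid (fun j => X j ω) (fun j => Z j ω) i 0

/-- The random supremum that enters the noise stability terms. -/
def randomSup (f : (Fin n → Block k d) → EuclideanSpace ℝ (Fin q))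
    (X : Fin n → Ω → EuclideanSpace ℝ (Fin d)) (Z : Fin n → Ω → Block k d) (i : Fin n)
    (w : Ω → Block k d) (r : ℕ) (ω : Ω) : ℝ≥0∞ :=
  segmentSup f (fun j => X j ω) (fun j => Z j ω) i r (w ω)

lemma continuous_replicateVec : Continuous (replicateVec (d := d) k) := by
  unfold replicateVec
  fun_prop

lemma aemeasurable_basePoint (hX : ∀ j, AEMeasurable (X j) μ) (hZ : ∀ j, AEMeasurable (Z j) μ) :
    AEMeasurable (basePoint X Z i) μ := by
  refine aemeasurable_pi_lambda _ fun j => ?_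
  simp only [basePoint, hybrid]
  split_ifs
  · exact continuous_replicateVec.measurable.comp_aemeasurable (hX j)
  · exact aemeasurable_const
  · exact hZ j

/-- The path bounds, scaled by the powers of the norm of the direction. -/
def scaledBound (f : (Fin n → Block k d) → EuclideanSpace ℝ (Fin q))
    (X : Fin n → Ω → EuclideanSpace ℝ (Fin d)) (Z : Fin n → Ω → Block k d) (i : Fin n)
    (w : Ω → Block k d) (r : ℕ) (ω : Ω) : ℝ≥0∞ :=
  lineBound f (basePoint X Z i ω) (blockIncl k d i (w ω)) r / ‖w ω‖ₑ ^ r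

lemma aemeasurable_scaledBound (hf : TimesDifferentiable 3 f) (hX : ∀ j, AEMeasurable (X j) μ)
    (hZ : ∀ j, AEMeasurable (Z j) μ) (hw : AEMeasurable w μ) (r : ℕ) :
    AEMeasurable (scaledBound f X Z i w r) μ :=
  ((measurable_lineBound hf r).comp_aemeasurable ((aemeasurable_basePoint hX hZ).prodMk
    ((blockIncl k d i).continuous.measurable.comp_aemeasurable hw))).div (hw.enorm.pow_const r)

omit [MeasurableSpace Ω] in
lemma scaledBound_le_randomSup (hf : TimesDifferentiable 3 f) {r : ℕ} (hr : r ≤ 3) (ω : Ω) :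
    scaledBound f X Z i w r ω ≤ randomSup f X Z i w r ω :=
  ENNReal.div_le_of_le_mul (hf.lineBound_le _ _ i hr _)

omit [MeasurableSpace Ω] in
-- Dividing by `‖w‖^r` loses nothing where that power is zero: the path bound is then at most
-- `segmentSup * 0`, which is `0` even for an infinite supremum.
lemma lineBound_eq_scaledBound_mul (hf : TimesDifferentiable 3 f) {r : ℕ} (hr : r ≤ 3) (ω : Ω) :
    lineBound f (basePoint X Z i ω) (blockIncl k d i (w ω)) r
      = scaledBound f X Z i w r ω * ‖w ω‖ₑ ^ r := by
  rcases eq_or_ne (‖w ω‖ₑ ^ r) 0 with h0 | h0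
  · have := hf.lineBound_le (fun j => X j ω) (fun j => Z j ω) i hr (w ω)
    rw [h0, mul_zero, nonpos_iff_eq_zero] at this
    rw [h0, mul_zero]
    exact this
  · exact (ENNReal.div_mul_cancel h0 (by simp)).symm

lemma lintegral_enorm_remainder_le (hf : TimesDifferentiable 3 f) (hh : TimesDifferentiable 3 h)
    (hγ : gammaThree h ≠ ∞) (hX : ∀ j, AEMeasurable (X j) μ) (hZ : ∀ j, AEMeasurable (Z j) μ)
    (hw : AEMeasurable w μ) {α : ℕ → ℕ → ℝ≥0∞}
    (hα : ∀ r m : ℕ, (∫⁻ ω, randomSup f X Z i w r ω ^ m ∂μ) ^ (1 / m : ℝ) ≤ α r m) :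
    ∫⁻ ω, ‖h (f (basePoint X Z i ω + blockIncl k d i (w ω))) - h (f (basePoint X Z i ω))
        - taylorPart h f (basePoint X Z i ω) (blockIncl k d i (w ω))‖ₑ ∂μ
      ≤ lambdaTwo h α * (∫⁻ ω, ‖w ω‖ₑ ^ 6 ∂μ) ^ (1 / 2 : ℝ) / 6 := by
  set c := scaledBound f X Z i w with hc
  have hmul : ∀ r < 4, ∀ ω, lineBound f (basePoint X Z i ω) (blockIncl k d i (w ω)) r
      = c r ω * ‖w ω‖ₑ ^ r := fun r hr ω => lineBound_eq_scaledBound_mul hf (by omega) ω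
  have hpt : ∀ ω, ‖h (f (basePoint X Z i ω + blockIncl k d i (w ω))) - h (f (basePoint X Z i ω))
        - taylorPart h f (basePoint X Z i ω) (blockIncl k d i (w ω))‖ₑ
      ≤ smoothnessBound (gammaThree h) (etaNorm 2 h) (etaNorm 1 h) (fun r => c r ω)
        * ‖w ω‖ₑ ^ 3 / 6 := by
    intro ω
    set p := basePoint X Z i ω
    set v := blockIncl k d i (w ω)
    have := enorm_pathRemainder_le hh (derivNorm_three_le_toReal_gammaThree hγ)
      (fun t => hf.hasDerivAt_pathDeriv p v (by norm_num : 0 < 3) t)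
      (fun t => hf.hasDerivAt_pathDeriv p v (by norm_num : 1 < 3) t)
      (fun t => hf.hasDerivAt_pathDeriv p v (by norm_num : 2 < 3) t)
    rw [pathRemainder_eq, ENNReal.ofReal_toReal hγ] at this
    refine this.trans (ENNReal.div_le_div_right (le_of_eq ?_) 6)
    change smoothnessBound _ _ _ (lineBound f p v) = _
    unfold smoothnessBound
    -- Each monomial of `smoothnessBound` has total order three, so exactly `‖w‖³` factors out.
    rw [hmul 0 (by norm_num), hmul 1 (by norm_num), hmul 2 (by norm_num), hmul 3 (by norm_num)]
    ring
  refine (lintegral_mono hpt).trans ?_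
  simp_rw [ENNReal.div_eq_inv_mul]
  rw [lintegral_const_mul' _ _ (by simp)]
  gcongr
  refine (lintegral_smoothnessBound_mul_le (aemeasurable_scaledBound hf hX hZ hw) hw.enorm (α := α) fun r hr m =>
    le_trans ?_ (hα r m))
  gcongr with ω
  exact scaledBound_le_randomSup hf (by omega) ω

/-- `S` need not be measurable: the lower integral is monotone and commutes with a finite constant
factor in any case. -/
lemma memLp_six_of_enorm_le {F : Type*} [NormedAddCommGroup F] {Y : Ω → F}
    (hY : AEStronglyMeasurable Y μ) {S : Ω → ℝ≥0∞} {C : ℝ≥0∞} (hC : C ≠ ∞)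
    (hS : (∫⁻ ω, S ω ^ 6 ∂μ) ^ (1 / (6 : ℕ) : ℝ) ≠ ∞) (hle : ∀ ω, ‖Y ω‖ₑ ≤ S ω * C) :
    MemLp Y 6 μ := by
  refine ⟨hY, ?_⟩
  rw [eLpNorm_lt_top_iff_lintegral_rpow_enorm_lt_top (by norm_num) (by norm_num)]
  have h6 : (6 : ℝ≥0∞).toReal = (6 : ℕ) := by simp
  simp_rw [h6, ENNReal.rpow_natCast]
  have hS' : ∫⁻ ω, S ω ^ 6 ∂μ ≠ ∞ := fun h => hS (by rw [h]; simp)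
  calc ∫⁻ ω, ‖Y ω‖ₑ ^ 6 ∂μ ≤ ∫⁻ ω, S ω ^ 6 * C ^ 6 ∂μ := by
        gcongr with ω
        rw [← mul_pow]
        exact pow_le_pow_left' (hle ω) 6
    _ = (∫⁻ ω, S ω ^ 6 ∂μ) * C ^ 6 := lintegral_mul_const' _ _ (by simp [hC])
    _ < ∞ := ENNReal.mul_lt_top hS'.lt_top (by simp [hC.lt_top])

lemma memLp_iteratedFDeriv_basePoint (hf : TimesDifferentiable 3 f)
    (hX : ∀ j, AEMeasurable (X j) μ) (hZ : ∀ j, AEMeasurable (Z j) μ) {r : ℕ} (hr : r < 3)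
    (hS : (∫⁻ ω, randomSup f X Z i w r ω ^ 6 ∂μ) ^ (1 / (6 : ℕ) : ℝ) ≠ ∞)
    (m : Fin r → Block k d) :
    MemLp (fun ω => iteratedFDeriv ℝ r f (basePoint X Z i ω) (fun s => blockIncl k d i (m s)))
      6 μ := by
  have hc : Continuous fun p => iteratedFDeriv ℝ r f p (fun s => blockIncl k d i (m s)) :=
    hf.continuous_eval hr continuous_id continuous_const
  refine memLp_six_of_enorm_le (S := randomSup f X Z i w r) (C := ∏ s, ‖m s‖ₑ)
    (hc.measurable.comp_aemeasurable (aemeasurable_basePoint hX hZ)).aestronglyMeasurable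
    (by exact ENNReal.prod_ne_top fun s _ => by simp) hS fun ω => ?_
  -- The base point is the endpoint `t = 0` of the segment.
  have := enorm_iteratedFDeriv_le_segmentSup (f := f) (fun j => X j ω) (fun j => Z j ω) i r (w ω)
    (t := 0) (by simp) m
  rw [zero_smul, hf.iteratedFDeriv_comp_affine _ _ hr] at this
  simpa [randomSup, basePoint] using this

lemma memLp_comp_hybrid (hf : TimesDifferentiable 3 f)
    (hX : ∀ j, AEMeasurable (X j) μ) (hZ : ∀ j, AEMeasurable (Z j) μ) (hw : AEMeasurable w μ)
    (hS : (∫⁻ ω, randomSup f X Z i w 0 ω ^ 6 ∂μ) ^ (1 / (6 : ℕ) : ℝ) ≠ ∞) :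
    MemLp (fun ω => f (basePoint X Z i ω + blockIncl k d i (w ω))) 6 μ := by
  refine memLp_six_of_enorm_le (S := randomSup f X Z i w 0) (C := 1)
    (hf.continuous.measurable.comp_aemeasurable ((aemeasurable_basePoint hX hZ).add
      ((blockIncl k d i).continuous.measurable.comp_aemeasurable hw))).aestronglyMeasurable
    (by simp) hS fun ω => ?_
  have := hf.enorm_pathDeriv_le (fun j => X j ω) (fun j => Z j ω) i (r := 0) (by norm_num) (w ω)
    (t := 1) (by simp)
  simpa [pathDeriv_zero, randomSup, basePoint] using this

lemma integrable_pow_three_of_memLp [IsProbabilityMeasure μ] {K : Ω → ℝ} (hK : MemLp K 6 μ) :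
    Integrable (fun ω => K ω ^ 3) μ := by
  have h1 : MemLp K 3 μ := hK.mono_exponent (by norm_num)
  have := h1.integrable_norm_pow (p := 3) (by norm_num)
  refine this.mono' (h1.1.pow 3) (Eventually.of_forall fun ω => ?_)
  simp

variable [IsProbabilityMeasure μ]

lemma integrable_testFunction_comp (hh : TimesDifferentiable 3 h) (hγ : gammaThree h ≠ ∞)
    {Y : Ω → EuclideanSpace ℝ (Fin q)} (hY : MemLp Y 6 μ) : Integrable (fun ω => h (Y ω)) μ := by
  have hK := (memLp_const (1 : ℝ)).add hY.norm
  refine ((integrable_pow_three_of_memLp hK).const_mul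
    (|h 0| + derivNorm 1 h 0 + derivNorm 2 h 0 + (gammaThree h).toReal)).mono'
    (hh.continuous.comp_aestronglyMeasurable hY.1) (Eventually.of_forall fun ω => ?_)
  have := norm_nonneg (Y ω)
  simp only [Pi.add_apply]
  exact abs_testFunction_le_pow hh (derivNorm_three_le_toReal_gammaThree hγ) _
    (by linarith) (by linarith)

lemma integrable_linCoeff_basePoint (hf : TimesDifferentiable 3 f) (hh : TimesDifferentiable 3 h)
    (hγ : gammaThree h ≠ ∞) (hX : ∀ j, AEMeasurable (X j) μ) (hZ : ∀ j, AEMeasurable (Z j) μ)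
    (hS : ∀ r < 3, (∫⁻ ω, randomSup f X Z i w r ω ^ 6 ∂μ) ^ (1 / (6 : ℕ) : ℝ) ≠ ∞)
    (a : Block k d) :
    Integrable (fun ω => linCoeff h f (blockIncl k d i a) (basePoint X Z i ω)) μ := by
  have m0 := memLp_iteratedFDeriv_basePoint hf hX hZ (by norm_num) (hS 0 (by norm_num)) ![]
  have m1 := memLp_iteratedFDeriv_basePoint hf hX hZ (by norm_num) (hS 1 (by norm_num)) ![a]
  -- One plus the norms of all arguments serves as the dominating `K` in the cubic growth bounds.
  have hK := ((memLp_const (1 : ℝ)).add m0.norm).add m1.norm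
  refine ((integrable_pow_three_of_memLp hK).const_mul
    (derivNorm 1 h 0 + derivNorm 2 h 0 + (gammaThree h).toReal)).mono'
    ((continuous_linCoeff hh hf _).measurable.comp_aemeasurable
      (aemeasurable_basePoint hX hZ)).aestronglyMeasurable (Eventually.of_forall fun ω => ?_)
  have e1 : (fun s => blockIncl k d i ((![a] : Fin 1 → Block k d) s)) = ![blockIncl k d i a] := by
    funext s; fin_cases s; rfl
  have n0 := norm_nonneg (f (basePoint X Z i ω))
  have n1 := norm_nonneg (iteratedFDeriv ℝ 1 f (basePoint X Z i ω) ![blockIncl k d i a])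
  simp only [Pi.add_apply, iteratedFDeriv_zero_apply, e1]
  exact abs_iteratedFDeriv_one_le_pow hh (derivNorm_three_le_toReal_gammaThree hγ) _ _
    (by linarith) (by linarith) (by linarith)

lemma integrable_quadCoeff_basePoint (hf : TimesDifferentiable 3 f) (hh : TimesDifferentiable 3 h)
    (hγ : gammaThree h ≠ ∞) (hX : ∀ j, AEMeasurable (X j) μ) (hZ : ∀ j, AEMeasurable (Z j) μ)
    (hS : ∀ r < 3, (∫⁻ ω, randomSup f X Z i w r ω ^ 6 ∂μ) ^ (1 / (6 : ℕ) : ℝ) ≠ ∞)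
    (a b : Block k d) :
    Integrable (fun ω => quadCoeff h f (blockIncl k d i a) (blockIncl k d i b)
      (basePoint X Z i ω)) μ := by
  have m0 := memLp_iteratedFDeriv_basePoint hf hX hZ (by norm_num) (hS 0 (by norm_num)) ![]
  have m1 := fun a => memLp_iteratedFDeriv_basePoint hf hX hZ (by norm_num)
    (hS 1 (by norm_num)) ![a]
  have m2 := memLp_iteratedFDeriv_basePoint hf hX hZ (by norm_num) (hS 2 (by norm_num)) ![a, b]
  have hK := ((((memLp_const (1 : ℝ)).add m0.norm).add (m1 a).norm).add (m1 b).norm).add m2.norm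
  refine ((integrable_pow_three_of_memLp hK).const_mul ((derivNorm 2 h 0
    + (gammaThree h).toReal) + (derivNorm 1 h 0 + derivNorm 2 h 0 + (gammaThree h).toReal))).mono'
    ((continuous_quadCoeff hh hf _ _).measurable.comp_aemeasurable
      (aemeasurable_basePoint hX hZ)).aestronglyMeasurable (Eventually.of_forall fun ω => ?_)
  have e1 : ∀ a, (fun s => blockIncl k d i ((![a] : Fin 1 → Block k d) s))
      = ![blockIncl k d i a] := by
    intro a; funext s; fin_cases s; rfl
  have e2 : (fun s => blockIncl k d i ((![a, b] : Fin 2 → Block k d) s))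
      = ![blockIncl k d i a, blockIncl k d i b] := by
    funext s; fin_cases s <;> rfl
  have n0 := norm_nonneg (f (basePoint X Z i ω))
  have n1 := norm_nonneg (iteratedFDeriv ℝ 1 f (basePoint X Z i ω) ![blockIncl k d i a])
  have n2 := norm_nonneg (iteratedFDeriv ℝ 1 f (basePoint X Z i ω) ![blockIncl k d i b])
  have n3 := norm_nonneg (iteratedFDeriv ℝ 2 f (basePoint X Z i ω)
    ![blockIncl k d i a, blockIncl k d i b])
  simp only [Pi.add_apply, iteratedFDeriv_zero_apply, e1, e2]
  have hG := derivNorm_three_le_toReal_gammaThree hγ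
  rw [add_mul]
  exact (abs_add_le _ _).trans (add_le_add
    (abs_iteratedFDeriv_two_le_pow hh hG _ _ _ (by linarith) (by linarith) (by linarith)
      (by linarith))
    (abs_iteratedFDeriv_one_le_pow hh hG _ _ (by linarith) (by linarith) (by linarith)))

lemma blockIncl_eq_sum (i : Fin n) (v : Block k d) :
    blockIncl k d i v = ∑ a, v a • blockIncl k d i (EuclideanSpace.single a (1 : ℝ)) := by
  have hv : v = ∑ a, v a • EuclideanSpace.single a (1 : ℝ) := by
    ext b
    simp [Finset.sum_apply, Pi.single_apply]
  conv_lhs => rw [hv, map_sum]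
  simp_rw [map_smul]

/-- The expectation of the first and second order terms depends on the direction only through its
first and second moments. -/
lemma integral_taylorPart_eq (hf : TimesDifferentiable 3 f) (hh : TimesDifferentiable 3 h)
    (hγ : gammaThree h ≠ ∞) (hX : ∀ j, AEMeasurable (X j) μ) (hZ : ∀ j, AEMeasurable (Z j) μ)
    {w₀ : Ω → Block k d}
    (hS : ∀ r < 3, (∫⁻ ω, randomSup f X Z i w₀ r ω ^ 6 ∂μ) ^ (1 / (6 : ℕ) : ℝ) ≠ ∞)
    (hw : MemLp w 2 μ) (hind : IndepFun (basePoint X Z i) w μ) :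
    Integrable (fun ω => taylorPart h f (basePoint X Z i ω) (blockIncl k d i (w ω))) μ ∧
    ∫ ω, taylorPart h f (basePoint X Z i ω) (blockIncl k d i (w ω)) ∂μ =
      ∑ a, (∫ ω, linCoeff h f (blockIncl k d i (EuclideanSpace.single a 1))
        (basePoint X Z i ω) ∂μ) * ∫ ω, w ω a ∂μ
      + (1 / 2) * ∑ a, ∑ b, (∫ ω, quadCoeff h f (blockIncl k d i (EuclideanSpace.single a 1))
        (blockIncl k d i (EuclideanSpace.single b 1)) (basePoint X Z i ω) ∂μ)
          * ∫ ω, w ω a * w ω b ∂μ := by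
  have hwa : ∀ a, MemLp (fun ω => w ω a) 2 μ := fun a =>
    hw.continuousLinearMap_comp (EuclideanSpace.proj (𝕜 := ℝ) a)
  have h1 := fun a => integrable_linCoeff_basePoint hf hh hγ hX hZ hS
    (EuclideanSpace.single a (1 : ℝ))
  have h2 := fun a b => integrable_quadCoeff_basePoint hf hh hγ hX hZ hS
    (EuclideanSpace.single a (1 : ℝ)) (EuclideanSpace.single b (1 : ℝ))
  -- Independence gives both the integrability of the products and the factorisation of their
  -- expectations.
  have i1 : ∀ a, IndepFun (fun ω => linCoeff h f (blockIncl k d i (EuclideanSpace.single a 1))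
      (basePoint X Z i ω)) (fun ω => w ω a) μ := fun a =>
    hind.comp (ψ := fun v : Block k d => v a)
      (continuous_linCoeff hh hf (blockIncl k d i (EuclideanSpace.single a 1))).measurable
      (by fun_prop)
  have i2 : ∀ a b, IndepFun (fun ω => quadCoeff h f (blockIncl k d i (EuclideanSpace.single a 1))
      (blockIncl k d i (EuclideanSpace.single b 1)) (basePoint X Z i ω))
      (fun ω => w ω a * w ω b) μ := fun a b =>
    hind.comp (ψ := fun v : Block k d => v a * v b)
      (continuous_quadCoeff hh hf (blockIncl k d i (EuclideanSpace.single a 1))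
        (blockIncl k d i (EuclideanSpace.single b 1))).measurable (by fun_prop)
  have w1 : ∀ a, Integrable (fun ω => w ω a) μ := fun a => (hwa a).integrable (by norm_num)
  have w2 : ∀ a b, Integrable (fun ω => w ω a * w ω b) μ := fun a b => (hwa a).integrable_mul (hwa b)
  have m1 : ∀ a, Integrable (fun ω => linCoeff h f (blockIncl k d i (EuclideanSpace.single a 1))
      (basePoint X Z i ω) * w ω a) μ := fun a => (i1 a).integrable_mul (h1 a) (w1 a)
  have m2 : ∀ a b, Integrable (fun ω => quadCoeff h f
      (blockIncl k d i (EuclideanSpace.single a 1)) (blockIncl k d i (EuclideanSpace.single b 1))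
      (basePoint X Z i ω) * (w ω a * w ω b)) μ :=
    fun a b => (i2 a b).integrable_mul (h2 a b) (w2 a b)
  have s1 := integrable_finsetSum Finset.univ fun a _ => m1 a
  have s2 := (integrable_finsetSum Finset.univ fun a _ =>
    integrable_finsetSum Finset.univ fun b _ => m2 a b).const_mul (1 / 2 : ℝ)
  have e : ∀ ω, taylorPart h f (basePoint X Z i ω) (blockIncl k d i (w ω)) =
      (∑ a, linCoeff h f (blockIncl k d i (EuclideanSpace.single a 1)) (basePoint X Z i ω) * w ω a)
      + (1 / 2) * ∑ a, ∑ b, quadCoeff h f (blockIncl k d i (EuclideanSpace.single a 1))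
        (blockIncl k d i (EuclideanSpace.single b 1)) (basePoint X Z i ω) * (w ω a * w ω b) :=
    fun ω => by rw [blockIncl_eq_sum, taylorPart_sum]
  simp_rw [e]
  refine ⟨s1.add s2, ?_⟩
  rw [integral_add s1 s2, integral_const_mul,
    integral_finsetSum _ fun a _ => m1 a,
    integral_finsetSum _ fun a _ => integrable_finsetSum _ fun b _ => m2 a b]
  congr 1
  · exact Finset.sum_congr rfl fun a _ => (i1 a).integral_fun_mul_eq_mul_integral (h1 a).1 (w1 a).1
  · congr 1
    refine Finset.sum_congr rfl fun a _ => ?_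
    rw [integral_finsetSum _ fun b _ => m2 a b]
    exact Finset.sum_congr rfl fun b _ =>
      (i2 a b).integral_fun_mul_eq_mul_integral (h2 a b).1 (w2 a b).1

end Step

/-! ### The sixth moment of a real Gaussian -/

section GaussianMoment

/-- The sixth moment of a real Gaussian variable. -/
lemma integral_pow_six_gaussianReal (m : ℝ) (v : ℝ≥0) :
    ∫ x, x ^ 6 ∂(gaussianReal m v) = m ^ 6 + 15 * m ^ 4 * v + 45 * m ^ 2 * v ^ 2 + 15 * v ^ 3 := by
  have h0 : ∫ x, x ^ 6 ∂(gaussianReal m v) = iteratedDeriv 6 (mgf id (gaussianReal m v)) 0 := by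
    rw [iteratedDeriv_mgf_zero (by simp)]
    simp
  have hM : ∀ t, HasDerivAt (fun t : ℝ => Real.exp (m * t + v * t ^ 2 / 2))
      ((m + v * t) * Real.exp (m * t + v * t ^ 2 / 2)) t := by
    intro t
    have h1 : HasDerivAt (fun t : ℝ => m * t + v * t ^ 2 / 2) (m + v * t) t := by
      refine (((hasDerivAt_id t).const_mul m).add
        (((hasDerivAt_pow 2 t).const_mul (v : ℝ)).div_const 2)).congr_deriv ?_
      simp
      ring
    refine h1.exp.congr_deriv (mul_comm _ _)
  have hs : ∀ t : ℝ, HasDerivAt (fun t : ℝ => m + v * t) v t := by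
    intro t
    simpa using ((hasDerivAt_id t).const_mul (v : ℝ)).const_add m
  -- With `s = m + v t`, differentiating `Q(s)` times the exponential replaces `Q` by `v Q' + s Q`.
  -- Six applications to `Q = 1` give the moment polynomial, read off at `t = 0`.
  have step : ∀ (Q : ℝ → ℝ) (Q' : ℝ → ℝ), (∀ s, HasDerivAt Q (Q' s) s) →
      deriv (fun t : ℝ => Q (m + v * t) * Real.exp (m * t + v * t ^ 2 / 2)) =
        fun t => (v * Q' (m + v * t) + (m + v * t) * Q (m + v * t))
          * Real.exp (m * t + v * t ^ 2 / 2) := by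
    intro Q Q' hQ
    funext t
    have := (((hQ (m + v * t)).comp t (hs t)).mul (hM t)).deriv
    refine Eq.trans this ?_
    simp only [Function.comp]
    ring
  have e1 := step (fun _ => 1) (fun _ => 0) (fun s => hasDerivAt_const s 1)
  have e2 := step (fun s => s) (fun _ => 1) (fun s => hasDerivAt_id s)
  have e3 := step (fun s => s ^ 2 + v) (fun s => 2 * s)
    (fun s => by simpa using (hasDerivAt_pow 2 s).add_const (v : ℝ))
  have e4 := step (fun s => s ^ 3 + 3 * v * s) (fun s => 3 * s ^ 2 + 3 * v)
    (fun s => by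
      simpa using! (hasDerivAt_pow 3 s).add ((hasDerivAt_id s).const_mul (3 * (v : ℝ))))
  have e5 := step (fun s => s ^ 4 + 6 * v * s ^ 2 + 3 * v ^ 2) (fun s => 4 * s ^ 3 + 12 * v * s)
    (fun s => by
      refine (((hasDerivAt_pow 4 s).add ((hasDerivAt_pow 2 s).const_mul (6 * (v : ℝ)))).add_const
        (3 * (v : ℝ) ^ 2)).congr_deriv ?_
      simp; ring)
  have e6 := step (fun s => s ^ 5 + 10 * v * s ^ 3 + 15 * v ^ 2 * s)
    (fun s => 5 * s ^ 4 + 30 * v * s ^ 2 + 15 * v ^ 2)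
    (fun s => by
      refine (((hasDerivAt_pow 5 s).add ((hasDerivAt_pow 3 s).const_mul (10 * (v : ℝ)))).add
        ((hasDerivAt_id s).const_mul (15 * (v : ℝ) ^ 2))).congr_deriv ?_
      simp; ring)
  have f0 : mgf id (gaussianReal m v) = fun t => 1 * Real.exp (m * t + v * t ^ 2 / 2) := by
    simp [mgf_id_gaussianReal]
  have f1 : deriv (mgf id (gaussianReal m v)) =
      fun t => (m + v * t) * Real.exp (m * t + v * t ^ 2 / 2) := by
    rw [f0, e1]; funext t; ring
  have f2 : deriv (deriv (mgf id (gaussianReal m v))) =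
      fun t => ((m + v * t) ^ 2 + v) * Real.exp (m * t + v * t ^ 2 / 2) := by
    rw [f1, e2]; funext t; ring
  have f3 : deriv (deriv (deriv (mgf id (gaussianReal m v)))) =
      fun t => ((m + v * t) ^ 3 + 3 * v * (m + v * t)) * Real.exp (m * t + v * t ^ 2 / 2) := by
    rw [f2, e3]; funext t; ring
  have f4 : deriv (deriv (deriv (deriv (mgf id (gaussianReal m v))))) =
      fun t => ((m + v * t) ^ 4 + 6 * v * (m + v * t) ^ 2 + 3 * v ^ 2)
        * Real.exp (m * t + v * t ^ 2 / 2) := by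
    rw [f3, e4]; funext t; ring
  have f5 : deriv (deriv (deriv (deriv (deriv (mgf id (gaussianReal m v)))))) =
      fun t => ((m + v * t) ^ 5 + 10 * v * (m + v * t) ^ 3 + 15 * v ^ 2 * (m + v * t))
        * Real.exp (m * t + v * t ^ 2 / 2) := by
    rw [f4, e5]; funext t; ring
  rw [h0]
  simp only [iteratedDeriv_succ, iteratedDeriv_zero]
  rw [f5, e6]
  simp
  ring

/-- Expanding the cube dominates the exact moment term by term. The quantity `m² + v` is the second
moment, which the surrogate shares with the data. -/
lemma integral_pow_six_gaussianReal_le (m : ℝ) (v : ℝ≥0) :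
    ∫ x, x ^ 6 ∂(gaussianReal m v) ≤ 15 * (m ^ 2 + v) ^ 3 := by
  rw [integral_pow_six_gaussianReal]
  have hv := v.2
  have : 0 ≤ m ^ 6 := by positivity
  have : 0 ≤ m ^ 4 * v := by positivity
  nlinarith

end GaussianMoment

/-! ### Moments of the Gaussian surrogate -/

section Surrogate

variable {d k : ℕ} {P : Measure (EuclideanSpace ℝ (Fin d))} [IsProbabilityMeasure P]

omit [IsProbabilityMeasure P] in
lemma memLp_six_of_integrable (hP : Integrable (fun x => ‖x‖ ^ 6) P) : MemLp id 6 P := by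
  refine (integrable_norm_rpow_iff (by fun_prop) (by norm_num) (by norm_num)).1 ?_
  simpa using hP

lemma memLp_coord {ι : Type*} [Fintype ι] {ν : Measure (EuclideanSpace ℝ ι)} {p : ℝ≥0∞}
    (hP : MemLp id p ν) (l : ι) : MemLp (fun x => x l) p ν :=
  hP.continuousLinearMap_comp (EuclideanSpace.proj (𝕜 := ℝ) l)

/-- The quadratic form is the variance of a linear functional. Positive semidefiniteness is required
by the covariance formula for `multivariateGaussian`. -/
lemma posSemidef_covMat (hP : MemLp id 2 P) : (covMat P).PosSemidef := by
  refine Matrix.PosSemidef.of_dotProduct_mulVec_nonneg ?_ fun x => ?_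
  · ext a b
    simp [covMat, covariance_comm]
  · have h1 := covarianceBilin_apply_pi (μ := P) (X := fun l x => x l)
      (fun l => memLp_coord hP l) (WithLp.toLp 2 x) (WithLp.toLp 2 x)
    have h2 := covarianceBilin_self_nonneg
      (μ := P.map (fun ω : EuclideanSpace ℝ (Fin d) => WithLp.toLp 2 fun l => ω l))
      (WithLp.toLp 2 x)
    rw [h1] at h2
    refine h2.trans (le_of_eq ?_)
    simp only [dotProduct, Matrix.mulVec, covMat, Matrix.of_apply, Finset.mul_sum, star_trivial]
    exact Finset.sum_congr rfl fun a _ => Finset.sum_congr rfl fun b _ => by ring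

lemma posSemidef_surrogate (hP : MemLp id 2 P) :
    (Matrix.kronecker (Matrix.of fun _ _ : Fin k => (1 : ℝ)) (covMat P)).PosSemidef := by
  refine Matrix.PosSemidef.kronecker ?_ (posSemidef_covMat hP)
  convert! Matrix.posSemidef_vecMulVec_self_star (fun _ : Fin k => (1 : ℝ)) using 1
  ext a b
  simp [Matrix.vecMulVec]

instance isGaussian_gaussianSurrogate : IsGaussian (gaussianSurrogate k P) :=
  isGaussian_multivariateGaussian

lemma integral_coord (hP : MemLp id 2 P) (l : Fin d) : ∫ x, x l ∂P = (∫ x, x ∂P) l :=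
  (EuclideanSpace.proj (𝕜 := ℝ) l).integral_comp_comm (hP.integrable (by norm_num))

lemma integral_coord_surrogate (hP : MemLp id 2 P) (a : Fin k × Fin d) :
    ∫ z, z a ∂(gaussianSurrogate k P) = ∫ x, x a.2 ∂P := by
  have h1 : ∫ z, z a ∂(gaussianSurrogate k P) = (∫ z, z ∂(gaussianSurrogate k P)) a :=
    (EuclideanSpace.proj (𝕜 := ℝ) a).integral_comp_comm IsGaussian.integrable_id
  rw [h1, integral_coord hP, gaussianSurrogate, integral_id_multivariateGaussian]
  rfl

/-- The all-ones factor makes the covariance blind to the block indices; since the means agree as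
well, so do the raw second moments. -/
lemma integral_coord_mul_coord_surrogate (hP : MemLp id 2 P) (a b : Fin k × Fin d) :
    ∫ z, z a * z b ∂(gaussianSurrogate k P) = ∫ x, x a.2 * x b.2 ∂P := by
  have hG : MemLp id 2 (gaussianSurrogate k P) := IsGaussian.memLp_two_id
  have h1 := covariance_eq_sub (memLp_coord hG a) (memLp_coord hG b)
  have h2 := covariance_eq_sub (memLp_coord hP a.2) (memLp_coord hP b.2)
  have h3 : cov[fun z => z a, fun z => z b; gaussianSurrogate k P]
      = cov[fun x => x a.2, fun x => x b.2; P] := by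
    rw [gaussianSurrogate, covariance_eval_multivariateGaussian (posSemidef_surrogate hP)]
    simp [covMat, Matrix.kronecker]
  rw [h1, h2, integral_coord_surrogate hP, integral_coord_surrogate hP] at h3
  have := sub_left_inj.1 h3
  simpa using this

lemma integral_coord_pow_six_surrogate_le (hP : MemLp id 2 P) (a : Fin k × Fin d) :
    ∫ z, z a ^ 6 ∂(gaussianSurrogate k P) ≤ 15 * (∫ x, x a.2 ^ 2 ∂P) ^ 3 := by
  have hS := posSemidef_surrogate (k := k) hP
  have hmp := measurePreserving_eval_multivariateGaussian
    (μ := replicateVec k (∫ x, x ∂P)) hS (i := a)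
  have h1 : ∫ z, z a ^ 6 ∂(gaussianSurrogate k P) = ∫ y, y ^ 6 ∂(gaussianReal _ _) :=
    (hmp.hasLaw.integral_comp (f := fun y : ℝ => y ^ 6) (by fun_prop))
  rw [h1]
  refine (integral_pow_six_gaussianReal_le _ _).trans (le_of_eq ?_)
  congr 2
  rw [Real.coe_toNNReal _ hS.diag_nonneg]
  have hG : MemLp id 2 (gaussianSurrogate k P) := IsGaussian.memLp_two_id
  have h2 := covariance_eq_sub (memLp_coord hP a.2) (memLp_coord hP a.2)
  have h3 : Matrix.kronecker (Matrix.of fun _ _ : Fin k => (1 : ℝ)) (covMat P) a a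
      = cov[fun x => x a.2, fun x => x a.2; P] := by
    simp [covMat, Matrix.kronecker]
  have h4 : (replicateVec k (∫ x, x ∂P)) a = ∫ x, x a.2 ∂P := (integral_coord hP a.2).symm
  rw [h3, h2, h4]
  simp only [Pi.mul_apply, ← pow_two]
  ring

/-- Minkowski's inequality in `L³` for `‖z‖² = ∑ z_a²`: each summand has norm at most `15^{1/3} E
X_l²`, the `k` blocks add up to `15^{1/3} k E‖X‖²`, and after cubing Jensen gives `(E‖X‖²)³ ≤
E‖X‖⁶`. -/
lemma lintegral_enorm_pow_six_surrogate_le (hP : MemLp id 6 P) :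
    ∫⁻ z, ‖z‖ₑ ^ 6 ∂(gaussianSurrogate k P) ≤ 15 * k ^ 3 * ∫⁻ x, ‖x‖ₑ ^ 6 ∂P := by
  have hP2 : MemLp id 2 P := hP.mono_exponent (by norm_num)
  set ν := gaussianSurrogate k P with hν
  have hG : MemLp id 6 ν := IsGaussian.memLp_id ν 6 (by norm_num)
  have hpow : ∀ {Ω : Type} [MeasurableSpace Ω] (ρ : Measure Ω) (g : Ω → ℝ),
      eLpNorm g 3 ρ ^ 3 = ∫⁻ ω, ‖g ω‖ₑ ^ 3 ∂ρ := by
    intro Ω _ ρ g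
    rw [eLpNorm_eq_lintegral_rpow_enorm_toReal (by norm_num) (by norm_num), ← ENNReal.rpow_natCast,
      ← ENNReal.rpow_mul]
    simp
  have hsq : ∀ a, eLpNorm (fun z : Block k d => z a ^ 2) 3 ν
      ≤ ENNReal.ofReal 15 ^ (1 / 3 : ℝ) * ENNReal.ofReal (∫ x, x a.2 ^ 2 ∂P) := by
    intro a
    rw [eLpNorm_eq_lintegral_rpow_enorm_toReal (by norm_num) (by norm_num)]
    have h1 : ∫⁻ z : Block k d, ‖z a ^ 2‖ₑ ^ (3 : ℝ≥0∞).toReal ∂ν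
        = ENNReal.ofReal (∫ z, z a ^ 6 ∂ν) := by
      have hi : Integrable (fun z : Block k d => z a ^ 6) ν := by
        have := (memLp_coord hG a).integrable_norm_pow (p := 6) (by norm_num)
        refine this.congr (Eventually.of_forall fun z => ?_)
        simp only [Real.norm_eq_abs]
        exact Even.pow_abs (by decide) _
      rw [ofReal_integral_eq_lintegral_ofReal hi (Eventually.of_forall fun z => by positivity)]
      refine lintegral_congr fun z => ?_
      rw [show (3 : ℝ≥0∞).toReal = (3 : ℕ) by simp, ENNReal.rpow_natCast, ← enorm_pow,
        Real.enorm_of_nonneg (by positivity)]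
      congr 1
      ring
    rw [h1, show (3 : ℝ≥0∞).toReal = 3 by simp]
    have h15 := ENNReal.ofReal_le_ofReal (integral_coord_pow_six_surrogate_le (k := k) hP2 a)
    refine (ENNReal.rpow_le_rpow h15 (by norm_num)).trans (le_of_eq ?_)
    have hnn : 0 ≤ ∫ x, x a.2 ^ 2 ∂P := integral_nonneg fun x => by positivity
    rw [ENNReal.ofReal_mul (by norm_num), ENNReal.mul_rpow_of_nonneg _ _ (by norm_num),
      ENNReal.ofReal_pow hnn, ← ENNReal.rpow_natCast, ← ENNReal.rpow_mul]
    norm_num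
  have hnorm : (fun z : Block k d => ‖z‖ ^ 2) = ∑ a, fun z : Block k d => z a ^ 2 := by
    funext z
    rw [EuclideanSpace.real_norm_sq_eq, Finset.sum_apply]
  have hs : ENNReal.ofReal (∫ x, ‖x‖ ^ 2 ∂P) = ∫⁻ x, ‖x‖ₑ ^ 2 ∂P := by
    have hi : Integrable (fun x => ‖x‖ ^ 2) P := hP2.integrable_norm_pow (p := 2) (by norm_num)
    rw [ofReal_integral_eq_lintegral_ofReal hi
      (Eventually.of_forall fun z => by positivity)]
    refine lintegral_congr fun z => ?_
    rw [ENNReal.ofReal_pow (norm_nonneg _), ofReal_norm]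
  have hsum : ∑ a : Fin k × Fin d, ENNReal.ofReal (∫ x, x a.2 ^ 2 ∂P)
      = k * ∫⁻ x, ‖x‖ₑ ^ 2 ∂P := by
    rw [Fintype.sum_prod_type]
    simp only [Finset.sum_const, Finset.card_univ, Fintype.card_fin, nsmul_eq_mul]
    rw [← hs, ← ENNReal.ofReal_sum_of_nonneg (fun a _ => integral_nonneg fun x => by positivity),
      ← integral_finsetSum _ fun a _ => (memLp_coord hP2 a).integrable_sq]
    simp_rw [EuclideanSpace.real_norm_sq_eq]
  have h3 : eLpNorm (fun z : Block k d => ‖z‖ ^ 2) 3 ν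
      ≤ ENNReal.ofReal 15 ^ (1 / 3 : ℝ) * (k * ∫⁻ x, ‖x‖ₑ ^ 2 ∂P) := by
    rw [hnorm]
    refine (eLpNorm_sum_le (fun a _ => by fun_prop) (by norm_num)).trans ?_
    refine (Finset.sum_le_sum fun a _ => hsq a).trans (le_of_eq ?_)
    rw [← Finset.mul_sum, hsum]
  have hj : (∫⁻ x, ‖x‖ₑ ^ 2 ∂P) ^ 3 ≤ ∫⁻ x, ‖x‖ₑ ^ 6 ∂P := by
    have := eLpNorm_le_eLpNorm_of_exponent_le (μ := P) (p := 1) (q := 3) (by norm_num)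
      (f := fun x : EuclideanSpace ℝ (Fin d) => ‖x‖ ^ 2) (by fun_prop)
    have := pow_le_pow_left' this 3
    rw [hpow, eLpNorm_one_eq_lintegral_enorm] at this
    simpa [← pow_mul] using this
  calc ∫⁻ z, ‖z‖ₑ ^ 6 ∂ν = eLpNorm (fun z : Block k d => ‖z‖ ^ 2) 3 ν ^ 3 := by
        rw [hpow]
        simp [← pow_mul]
    _ ≤ (ENNReal.ofReal 15 ^ (1 / 3 : ℝ) * (k * ∫⁻ x, ‖x‖ₑ ^ 2 ∂P)) ^ 3 := pow_le_pow_left' h3 3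
    _ = 15 * k ^ 3 * (∫⁻ x, ‖x‖ₑ ^ 2 ∂P) ^ 3 := by
        rw [mul_pow, ← ENNReal.rpow_natCast, ← ENNReal.rpow_mul]
        norm_num
        ring
    _ ≤ _ := by gcongr

lemma norm_replicateVec_sq (x : EuclideanSpace ℝ (Fin d)) :
    ‖replicateVec k x‖ ^ 2 = k * ‖x‖ ^ 2 := by
  rw [EuclideanSpace.real_norm_sq_eq, EuclideanSpace.real_norm_sq_eq, Fintype.sum_prod_type]
  simp [replicateVec]

lemma enorm_replicateVec_pow_six (x : EuclideanSpace ℝ (Fin d)) :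
    ‖replicateVec k x‖ₑ ^ 6 = k ^ 3 * ‖x‖ₑ ^ 6 := by
  have h : ‖replicateVec k x‖ ^ 6 = k ^ 3 * ‖x‖ ^ 6 := by
    have := congrArg (· ^ 3) (norm_replicateVec_sq (k := k) x)
    rw [mul_pow] at this
    rw [← pow_mul, ← pow_mul] at this
    exact this
  rw [← ofReal_norm, ← ofReal_norm, ← ENNReal.ofReal_pow (norm_nonneg _), h,
    ENNReal.ofReal_mul (by positivity), ENNReal.ofReal_pow (norm_nonneg _),
    ENNReal.ofReal_pow (by positivity), ENNReal.ofReal_natCast]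

end Surrogate

/-! ### One Lindeberg replacement -/

section Lindeberg

variable {k d n q : ℕ} {P : Measure (EuclideanSpace ℝ (Fin d))} [IsProbabilityMeasure P]
  {Ω : Type*} [MeasurableSpace Ω] {μ : Measure Ω} [IsProbabilityMeasure μ]
  {X : Fin n → Ω → EuclideanSpace ℝ (Fin d)} {Z : Fin n → Ω → Block k d}
  {f : (Fin n → Block k d) → EuclideanSpace ℝ (Fin q)} {h : EuclideanSpace ℝ (Fin q) → ℝ}
  {i : Fin n}

/-- The replicated data point. -/
def replData (k : ℕ) (X : Fin n → Ω → EuclideanSpace ℝ (Fin d)) (i : Fin n) (ω : Ω) : Block k d :=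
  replicateVec k (X i ω)

omit [IsProbabilityMeasure μ] in
lemma randomSup_replData_le (X : Fin n → Ω → EuclideanSpace ℝ (Fin d)) (Z : Fin n → Ω → Block k d)
    (f : (Fin n → Block k d) → EuclideanSpace ℝ (Fin q)) (i : Fin n) (r m : ℕ) :
    (∫⁻ ω, randomSup f X Z i (replData k X i) r ω ^ m ∂μ) ^ (1 / m : ℝ)
      ≤ noiseStability μ X Z f r m :=
  (le_max_left _ _).trans (le_iSup (fun i : Fin n => max
    ((∫⁻ ω, randomSup f X Z i (replData k X i) r ω ^ m ∂μ) ^ (1 / m : ℝ))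
    ((∫⁻ ω, randomSup f X Z i (Z i) r ω ^ m ∂μ) ^ (1 / m : ℝ))) i)

omit [IsProbabilityMeasure μ] in
lemma randomSup_gaussian_le (X : Fin n → Ω → EuclideanSpace ℝ (Fin d)) (Z : Fin n → Ω → Block k d)
    (f : (Fin n → Block k d) → EuclideanSpace ℝ (Fin q)) (i : Fin n) (r m : ℕ) :
    (∫⁻ ω, randomSup f X Z i (Z i) r ω ^ m ∂μ) ^ (1 / m : ℝ) ≤ noiseStability μ X Z f r m :=
  (le_max_right _ _).trans (le_iSup (fun i : Fin n => max
    ((∫⁻ ω, randomSup f X Z i (replData k X i) r ω ^ m ∂μ) ^ (1 / m : ℝ))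
    ((∫⁻ ω, randomSup f X Z i (Z i) r ω ^ m ∂μ) ^ (1 / m : ℝ))) i)

omit [IsProbabilityMeasure P] [IsProbabilityMeasure μ] in
lemma IsSampleWithSurrogate.aemeasurable_data (hs : IsSampleWithSurrogate P μ X Z) (j : Fin n) :
    AEMeasurable (X j) μ := (hs.hasLaw_data j).aemeasurable

omit [IsProbabilityMeasure P] [IsProbabilityMeasure μ] in
lemma IsSampleWithSurrogate.aemeasurable_gaussian (hs : IsSampleWithSurrogate P μ X Z)
    (j : Fin n) : AEMeasurable (Z j) μ := (hs.hasLaw_gaussian j).aemeasurable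

omit [IsProbabilityMeasure P] [IsProbabilityMeasure μ] in
lemma IsSampleWithSurrogate.aemeasurable_replData (hs : IsSampleWithSurrogate P μ X Z)
    (j : Fin n) : AEMeasurable (replData k X j) μ :=
  continuous_replicateVec.measurable.comp_aemeasurable (hs.aemeasurable_data j)

omit [IsProbabilityMeasure P] [IsProbabilityMeasure μ] in
-- With its `i`-th block set to `0`, the base point is a measurable function of the pairs with index
-- different from `i`. Dependence inside a pair is harmless.
lemma IsSampleWithSurrogate.indepFun_basePoint (hs : IsSampleWithSurrogate P μ X Z) (i : Fin n) :
    IndepFun (basePoint X Z i) (fun ω => (X i ω, Z i ω)) μ := by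
  have h1 := hs.indep.indepFun_finset₀ (Finset.univ.erase i) {i} (by simp)
    fun j => (hs.aemeasurable_data j).prodMk (hs.aemeasurable_gaussian j)
  let φ : (↥(Finset.univ.erase i) → EuclideanSpace ℝ (Fin d) × Block k d) →
      (Fin n → Block k d) := fun y j =>
    if hj : j = i then 0 else
      if j < i then replicateVec k (y ⟨j, by simpa using hj⟩).1
      else (y ⟨j, by simpa using hj⟩).2
  have hφ : Measurable φ := by
    refine measurable_pi_lambda _ fun j => ?_
    by_cases hj : j = i
    · simp [φ, hj]
    · by_cases hji : j < i
      · simp only [φ, hj, hji, dite_false, if_true]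
        exact continuous_replicateVec.measurable.comp (by fun_prop)
      · simp only [φ, hj, hji, dite_false, if_false]
        fun_prop
  have hψ : Measurable fun y : (↥({i} : Finset (Fin n)) → EuclideanSpace ℝ (Fin d) × Block k d) =>
      y ⟨i, Finset.mem_singleton_self i⟩ := measurable_pi_apply _
  have h2 := h1.comp hφ hψ
  convert h2 using 1
  · funext ω j
    by_cases hj : j = i
    · subst hj
      simp [basePoint, hybrid, φ]
    · by_cases hji : j < i <;> simp [basePoint, hybrid, φ, hj, hji]
  · rfl

omit [IsProbabilityMeasure P] [IsProbabilityMeasure μ] in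
lemma IsSampleWithSurrogate.lintegral_replData (hs : IsSampleWithSurrogate P μ X Z) (i : Fin n) :
    ∫⁻ ω, ‖replData k X i ω‖ₑ ^ 6 ∂μ = k ^ 3 * ∫⁻ x, ‖x‖ₑ ^ 6 ∂P := by
  simp only [replData, enorm_replicateVec_pow_six]
  rw [(hs.hasLaw_data i).lintegral_comp (f := fun x => (k : ℝ≥0∞) ^ 3 * ‖x‖ₑ ^ 6) (by fun_prop),
    lintegral_const_mul _ (by fun_prop)]

omit [IsProbabilityMeasure μ] in
lemma IsSampleWithSurrogate.lintegral_gaussian_le (hP : MemLp id 6 P)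
    (hs : IsSampleWithSurrogate P μ X Z) (i : Fin n) :
    ∫⁻ ω, ‖Z i ω‖ₑ ^ 6 ∂μ ≤ 15 * k ^ 3 * ∫⁻ x, ‖x‖ₑ ^ 6 ∂P := by
  rw [(hs.hasLaw_gaussian i).lintegral_comp (f := fun x => ‖x‖ₑ ^ 6) (by fun_prop)]
  exact lintegral_enorm_pow_six_surrogate_le hP

lemma memLp_two_of_lintegral {E : Type*} [NormedAddCommGroup E] {w : Ω → E}
    (hw : AEStronglyMeasurable w μ) (h : ∫⁻ ω, ‖w ω‖ₑ ^ 6 ∂μ ≠ ∞) : MemLp w 2 μ := by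
  have h6 : MemLp w 6 μ := by
    refine ⟨hw, ?_⟩
    rw [eLpNorm_lt_top_iff_lintegral_rpow_enorm_lt_top (by norm_num) (by norm_num)]
    have : (6 : ℝ≥0∞).toReal = (6 : ℕ) := by simp
    simp_rw [this, ENNReal.rpow_natCast]
    exact h.lt_top
  exact h6.mono_exponent (by norm_num)

omit [IsProbabilityMeasure P] in
lemma lintegral_enorm_pow_six_ne_top (hP : MemLp id 6 P) : ∫⁻ x, ‖x‖ₑ ^ 6 ∂P ≠ ∞ := by
  have := (eLpNorm_lt_top_iff_lintegral_rpow_enorm_lt_top (by norm_num) (by norm_num)).1 hP.2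
  have h6 : (6 : ℝ≥0∞).toReal = (6 : ℕ) := by simp
  simp_rw [h6, ENNReal.rpow_natCast] at this
  exact this.ne

/-- Replacing the `i`-th Gaussian vector by the `i`-th data point. -/
lemma IsSampleWithSurrogate.step (hP : MemLp id 6 P) (hs : IsSampleWithSurrogate P μ X Z)
    (hf : TimesDifferentiable 3 f) (hh : TimesDifferentiable 3 h) (hγ : gammaThree h ≠ ∞)
    (hα : ∀ r < 3, noiseStability μ X Z f r 6 ≠ ∞) (i : Fin n) :
    Integrable (fun ω => h (f (basePoint X Z i ω + blockIncl k d i (replData k X i ω)))) μ ∧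
    Integrable (fun ω => h (f (basePoint X Z i ω + blockIncl k d i (Z i ω)))) μ ∧
    ‖∫ ω, h (f (basePoint X Z i ω + blockIncl k d i (replData k X i ω))) ∂μ
      - ∫ ω, h (f (basePoint X Z i ω + blockIncl k d i (Z i ω))) ∂μ‖ₑ
      ≤ lambdaTwo h (noiseStability μ X Z f)
        * (k ^ 3 * ∫⁻ x, ‖x‖ₑ ^ 6 ∂P) ^ (1 / 2 : ℝ) := by
  have hX := hs.aemeasurable_data
  have hZ := hs.aemeasurable_gaussian
  have hR := hs.aemeasurable_replData
  have hP2 : MemLp id 2 P := hP.mono_exponent (by norm_num)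
  have hM := lintegral_enorm_pow_six_ne_top hP
  have hSX : ∀ r < 3, (∫⁻ ω, randomSup f X Z i (replData k X i) r ω ^ 6 ∂μ)
      ^ (1 / (6 : ℕ) : ℝ) ≠ ∞ := fun r hr =>
    ne_top_of_le_ne_top (hα r hr) (randomSup_replData_le X Z f i r 6)
  have hSZ : ∀ r < 3, (∫⁻ ω, randomSup f X Z i (Z i) r ω ^ 6 ∂μ)
      ^ (1 / (6 : ℕ) : ℝ) ≠ ∞ := fun r hr =>
    ne_top_of_le_ne_top (hα r hr) (randomSup_gaussian_le X Z f i r 6)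
  have wX : MemLp (replData k X i) 2 μ := memLp_two_of_lintegral (hR i).aestronglyMeasurable (by
    rw [hs.lintegral_replData]
    exact ENNReal.mul_ne_top (by simp) hM)
  have wZ : MemLp (Z i) 2 μ := memLp_two_of_lintegral (hZ i).aestronglyMeasurable
    (ne_top_of_le_ne_top (ENNReal.mul_ne_top (ENNReal.mul_ne_top (by simp) (by simp)) hM)
      (hs.lintegral_gaussian_le hP i))
  have hind := hs.indepFun_basePoint i
  have iX : IndepFun (basePoint X Z i) (replData k X i) μ :=
    hind.comp (ψ := fun y : EuclideanSpace ℝ (Fin d) × Block k d => replicateVec k y.1)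
      measurable_id (continuous_replicateVec.measurable.comp measurable_fst)
  have iZ : IndepFun (basePoint X Z i) (Z i) μ := hind.comp measurable_id measurable_snd
  obtain ⟨tX, eX⟩ := integral_taylorPart_eq hf hh hγ hX hZ hSX wX iX
  obtain ⟨tZ, eZ⟩ := integral_taylorPart_eq hf hh hγ hX hZ hSX wZ iZ
  have gX := integrable_testFunction_comp hh hγ (memLp_comp_hybrid hf hX hZ (hR i)
    (hSX 0 (by norm_num)))
  have gZ := integrable_testFunction_comp hh hγ (memLp_comp_hybrid hf hX hZ (hZ i)
    (hSZ 0 (by norm_num)))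
  have g0 : Integrable (fun ω => h (f (basePoint X Z i ω))) μ := by
    have := integrable_testFunction_comp hh hγ (memLp_iteratedFDeriv_basePoint hf hX hZ
      (by norm_num) (hSX 0 (by norm_num)) ![])
    simpa using this
  have m1 : ∀ a, ∫ ω, replData k X i ω a ∂μ = ∫ ω, Z i ω a ∂μ := by
    intro a
    have e1 := (hs.hasLaw_data i).integral_comp (f := fun x => x a.2) (by fun_prop)
    have e2 := (hs.hasLaw_gaussian i).integral_comp (f := fun x => x a) (by fun_prop)
    rw [integral_coord_surrogate hP2] at e2
    exact e1.trans e2.symm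
  have m2 : ∀ a b, ∫ ω, replData k X i ω a * replData k X i ω b ∂μ
      = ∫ ω, Z i ω a * Z i ω b ∂μ := by
    intro a b
    have e1 := (hs.hasLaw_data i).integral_comp (f := fun x => x a.2 * x b.2) (by fun_prop)
    have e2 := (hs.hasLaw_gaussian i).integral_comp (f := fun x => x a * x b) (by fun_prop)
    rw [integral_coord_mul_coord_surrogate hP2] at e2
    exact e1.trans e2.symm
  -- The moment matching: only first and second moments of the direction enter.
  have hT : ∫ ω, taylorPart h f (basePoint X Z i ω) (blockIncl k d i (replData k X i ω)) ∂μ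
      = ∫ ω, taylorPart h f (basePoint X Z i ω) (blockIncl k d i (Z i ω)) ∂μ := by
    rw [eX, eZ]
    simp_rw [m1, m2]
  refine ⟨gX, gZ, ?_⟩
  have rX := lintegral_enorm_remainder_le hf hh hγ hX hZ (hR i) (randomSup_replData_le X Z f i)
  have rZ := lintegral_enorm_remainder_le hf hh hγ hX hZ (hZ i) (randomSup_gaussian_le X Z f i)
  have hsplit : ∫ ω, h (f (basePoint X Z i ω + blockIncl k d i (replData k X i ω))) ∂μ
      - ∫ ω, h (f (basePoint X Z i ω + blockIncl k d i (Z i ω))) ∂μ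
      = ∫ ω, (h (f (basePoint X Z i ω + blockIncl k d i (replData k X i ω)))
          - h (f (basePoint X Z i ω))
          - taylorPart h f (basePoint X Z i ω) (blockIncl k d i (replData k X i ω))) ∂μ
        - ∫ ω, (h (f (basePoint X Z i ω + blockIncl k d i (Z i ω)))
          - h (f (basePoint X Z i ω))
          - taylorPart h f (basePoint X Z i ω) (blockIncl k d i (Z i ω))) ∂μ := by
    rw [integral_sub (by exact gX.sub g0) tX, integral_sub gX g0,
      integral_sub (by exact gZ.sub g0) tZ, integral_sub gZ g0, hT]
    ring
  rw [hsplit]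
  refine enorm_sub_le.trans ((add_le_add ((enorm_integral_le_lintegral_enorm _).trans rX)
    ((enorm_integral_le_lintegral_enorm _).trans rZ)).trans ?_)
  set A : ℝ≥0∞ := k ^ 3 * ∫⁻ x, ‖x‖ₑ ^ 6 ∂P
  -- The constant `4` is `√16`, from `15 ≤ 16`.
  have h15 : (∫⁻ ω, ‖Z i ω‖ₑ ^ 6 ∂μ) ^ (1 / 2 : ℝ) ≤ 4 * A ^ (1 / 2 : ℝ) := by
    have e4 : (4 : ℝ≥0∞) = (16 : ℝ≥0∞) ^ (1 / 2 : ℝ) := by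
      rw [show (16 : ℝ≥0∞) = 4 ^ (2 : ℝ) by norm_num, ← ENNReal.rpow_mul]
      norm_num
    rw [e4, ← ENNReal.mul_rpow_of_nonneg _ _ (by norm_num)]
    refine ENNReal.rpow_le_rpow ((hs.lintegral_gaussian_le hP i).trans ?_) (by norm_num)
    rw [mul_assoc]
    gcongr
    norm_num
  rw [hs.lintegral_replData]
  set L := lambdaTwo h (noiseStability μ X Z f)
  -- Data remainder `1/6` plus Gaussian remainder `4/6` stays below `1`.
  calc L * A ^ (1 / 2 : ℝ) / 6 + L * (∫⁻ ω, ‖Z i ω‖ₑ ^ 6 ∂μ) ^ (1 / 2 : ℝ) / 6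
      ≤ L * A ^ (1 / 2 : ℝ) / 6 + L * (4 * A ^ (1 / 2 : ℝ)) / 6 := by gcongr
    _ = (5 * (L * A ^ (1 / 2 : ℝ))) / 6 := by
        rw [ENNReal.div_add_div_same]
        congr 1
        ring
    _ ≤ (6 * (L * A ^ (1 / 2 : ℝ))) / 6 := by
        gcongr
        norm_num
    _ = L * A ^ (1 / 2 : ℝ) := by
        rw [mul_comm, ENNReal.mul_div_cancel_right (by norm_num) (by norm_num)]

end Lindeberg

/-! ### Telescoping, and the degenerate cases -/

section Telescope

variable {k d n q : ℕ} {P : Measure (EuclideanSpace ℝ (Fin d))} [IsProbabilityMeasure P]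
  {Ω : Type*} [MeasurableSpace Ω] {μ : Measure Ω} [IsProbabilityMeasure μ]
  {X : Fin n → Ω → EuclideanSpace ℝ (Fin d)} {Z : Fin n → Ω → Block k d}
  {f : (Fin n → Block k d) → EuclideanSpace ℝ (Fin q)} {h : EuclideanSpace ℝ (Fin q) → ℝ}

/-- The configuration with data in the first `m` blocks and Gaussian vectors in the others. -/
def mixedSample (X : Fin n → Ω → EuclideanSpace ℝ (Fin d)) (Z : Fin n → Ω → Block k d) (m : ℕ)
    (ω : Ω) : Fin n → Block k d :=
  fun j => if (j : ℕ) < m then replicateVec k (X j ω) else Z j ω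

omit [MeasurableSpace Ω] in
lemma mixedSample_zero (ω : Ω) : mixedSample X Z 0 ω = fun j => Z j ω := by
  funext j
  simp [mixedSample]

omit [MeasurableSpace Ω] in
lemma mixedSample_all (ω : Ω) : mixedSample X Z n ω = fun j => replicateVec k (X j ω) := by
  funext j
  simp [mixedSample]

omit [MeasurableSpace Ω] in
lemma basePoint_add_replData (i : Fin n) (ω : Ω) :
    basePoint X Z i ω + blockIncl k d i (replData k X i ω) = mixedSample X Z (i + 1) ω := by
  rw [basePoint, ← hybrid_eq_add]
  funext j
  rcases lt_trichotomy j i with hj | rfl | hj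
  · have : (j : ℕ) < i + 1 := Nat.lt_succ_of_lt hj
    simp [hybrid, mixedSample, hj, this]
  · simp [hybrid, mixedSample, replData]
  · have h1 : ¬ (j : ℕ) < i + 1 := by have : (i : ℕ) < j := hj; omega
    simp only [hybrid, mixedSample, hj.not_gt, hj.ne', h1, if_false]

omit [MeasurableSpace Ω] in
lemma basePoint_add_gaussian (i : Fin n) (ω : Ω) :
    basePoint X Z i ω + blockIncl k d i (Z i ω) = mixedSample X Z i ω := by
  rw [basePoint, ← hybrid_eq_add]
  funext j
  rcases lt_trichotomy j i with hj | rfl | hj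
  · simp [hybrid, mixedSample, hj]
  · simp [hybrid, mixedSample]
  · simp [hybrid, mixedSample, hj.not_gt, hj.ne']

lemma IsSampleWithSurrogate.integrable_mixedSample (hP : MemLp id 6 P)
    (hs : IsSampleWithSurrogate P μ X Z)
    (hf : TimesDifferentiable 3 f) (hh : TimesDifferentiable 3 h) (hγ : gammaThree h ≠ ∞)
    (hα : ∀ r < 3, noiseStability μ X Z f r 6 ≠ ∞) {m : ℕ} (hm : m ≤ n) :
    Integrable (fun ω => h (f (mixedSample X Z m ω))) μ := by
  rcases Nat.eq_zero_or_pos n with rfl | hn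
  · have : (fun ω => h (f (mixedSample X Z m ω))) = fun _ => h (f 0) := by
      funext ω
      rw [Subsingleton.elim (mixedSample X Z m ω) 0]
    rw [this]
    exact integrable_const _
  -- A configuration with `m < n` is the Gaussian side of exchange `m`; the last one is the data
  -- side of exchange `n - 1`.
  · rcases hm.lt_or_eq with hm | rfl
    · have := (hs.step hP hf hh hγ hα ⟨m, hm⟩).2.1
      simpa only [basePoint_add_gaussian] using this
    · have := (hs.step hP hf hh hγ hα ⟨m - 1, by omega⟩).1
      simp only [basePoint_add_replData] at this
      rwa [Nat.sub_add_cancel hn] at this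

/-- The Lindeberg bound for test functions with bounded third derivative. -/
lemma IsSampleWithSurrogate.enorm_integral_sub_le (hP : MemLp id 6 P)
    (hs : IsSampleWithSurrogate P μ X Z)
    (hf : TimesDifferentiable 3 f) (hh : TimesDifferentiable 3 h) (hγ : gammaThree h ≠ ∞)
    (hα : ∀ r < 3, noiseStability μ X Z f r 6 ≠ ∞) :
    ‖∫ ω, h (f fun i => replicateVec k (X i ω)) ∂μ - ∫ ω, h (f fun i => Z i ω) ∂μ‖ₑ
      ≤ n * (lambdaTwo h (noiseStability μ X Z f)
        * (k ^ 3 * ∫⁻ x, ‖x‖ₑ ^ 6 ∂P) ^ (1 / 2 : ℝ)) := by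
  have htel := Finset.sum_range_sub (fun m => ∫ ω, h (f (mixedSample X Z m ω)) ∂μ) n
  simp only [mixedSample_zero, mixedSample_all] at htel
  rw [← htel]
  refine (enorm_sum_le _ _).trans ((Finset.sum_le_card_nsmul _ _ _ fun m hm => ?_).trans
    (le_of_eq (by rw [Finset.card_range, nsmul_eq_mul])))
  have := (hs.step hP hf hh hγ hα ⟨m, Finset.mem_range.1 hm⟩).2.2
  simpa only [basePoint_add_gaussian, basePoint_add_replData] using this

omit [IsProbabilityMeasure μ] in
/-- If the first derivatives vanish along almost every segment, then `f` is almost surely constant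
along the segments. -/
lemma ae_comp_eq_of_randomSup_eq_zero (hf : TimesDifferentiable 3 f)
    (hX : ∀ j, AEMeasurable (X j) μ) (hZ : ∀ j, AEMeasurable (Z j) μ) {i : Fin n}
    {w : Ω → Block k d} (hw : AEMeasurable w μ)
    (h0 : (∫⁻ ω, randomSup f X Z i w 1 ω ^ 6 ∂μ) ^ (1 / (6 : ℕ) : ℝ) = 0) :
    ∀ᵐ ω ∂μ, f (basePoint X Z i ω + blockIncl k d i (w ω)) = f (basePoint X Z i ω) := by
  have h1 : ∫⁻ ω, scaledBound f X Z i w 1 ω ^ 6 ∂μ = 0 := by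
    rw [ENNReal.rpow_eq_zero_iff_of_pos (by norm_num)] at h0
    refine le_antisymm (le_trans ?_ h0.le) bot_le
    gcongr with ω
    exact scaledBound_le_randomSup hf (by norm_num) ω
  rw [lintegral_eq_zero_iff' ((aemeasurable_scaledBound hf hX hZ hw 1).pow_const 6)] at h1
  filter_upwards [h1] with ω hω
  have hb : supEnorm (pathDeriv f (basePoint X Z i ω) (blockIncl k d i (w ω)) 1) = 0 := by
    have := lineBound_eq_scaledBound_mul (X := X) (Z := Z) (i := i) (w := w) hf
      (show 1 ≤ 3 by norm_num) ω
    rw [pow_eq_zero_iff (by norm_num) |>.1 hω, zero_mul] at this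
    exact this
  set p := basePoint X Z i ω
  set v := blockIncl k d i (w ω)
  have hd := fun t => hf.hasDerivAt_pathDeriv p v (show 0 < 3 by norm_num) t
  have hd1 := fun t => hf.hasDerivAt_pathDeriv p v (show 1 < 3 by norm_num) t
  have hl : lipEnorm (pathDeriv f p v 0) ≤ 0 := lipEnorm_le hd fun t ht =>
    (enorm_le_supEnorm (continuous_iff_continuousAt.2 fun t => (hd1 t).continuousAt) ht).trans hb.le
  have := enorm_sub_le_lipEnorm (continuous_iff_continuousAt.2 fun t => (hd t).continuousAt)
    (show (1 : ℝ) ∈ Set.Icc (0 : ℝ) 1 by simp) (show (0 : ℝ) ∈ Set.Icc (0 : ℝ) 1 by simp)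
  rw [nonpos_iff_eq_zero.1 hl, zero_mul, nonpos_iff_eq_zero, enorm_eq_zero, sub_eq_zero,
    pathDeriv_zero, pathDeriv_zero] at this
  simpa using this

omit [IsProbabilityMeasure P] [IsProbabilityMeasure μ] in
-- In each exchange both segments start at the base point, so both endpoints take its value. This
-- serves the case `γ³(h) = ∞`, where `λ_2` may fail to be infinite.
lemma IsSampleWithSurrogate.ae_comp_eq_of_noiseStability_one_eq_zero
    (hs : IsSampleWithSurrogate P μ X Z) (hf : TimesDifferentiable 3 f)
    (hα : noiseStability μ X Z f 1 6 = 0) :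
    ∀ᵐ ω ∂μ, (f fun i => replicateVec k (X i ω)) = f fun i => Z i ω := by
  have hstep : ∀ i : Fin n, ∀ᵐ ω ∂μ,
      f (mixedSample X Z (i + 1) ω) = f (mixedSample X Z i ω) := by
    intro i
    have hX := hs.aemeasurable_data
    have hZ := hs.aemeasurable_gaussian
    have e1 := ae_comp_eq_of_randomSup_eq_zero (i := i) hf hX hZ (hs.aemeasurable_replData i)
      (nonpos_iff_eq_zero.1 (hα ▸ randomSup_replData_le X Z f i 1 6))
    have e2 := ae_comp_eq_of_randomSup_eq_zero (i := i) hf hX hZ (hZ i)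
      (nonpos_iff_eq_zero.1 (hα ▸ randomSup_gaussian_le X Z f i 1 6))
    filter_upwards [e1, e2] with ω h1 h2
    rw [← basePoint_add_replData, ← basePoint_add_gaussian, h1, h2]
  filter_upwards [ae_all_iff.2 hstep] with ω hω
  have : ∀ m ≤ n, f (mixedSample X Z m ω) = f (mixedSample X Z 0 ω) := by
    intro m
    induction m with
    | zero => exact fun _ => rfl
    | succ m ih => exact fun hm => (hω ⟨m, hm⟩).trans (ih (by omega))
  have := this n le_rfl
  rwa [mixedSample_zero, mixedSample_all] at this

omit [IsProbabilityMeasure μ] in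
-- The Gaussian sixth moment is at most `15` times the vanishing one, so replicate and surrogate are
-- both almost surely zero.
lemma IsSampleWithSurrogate.ae_eq_of_moment_eq_zero (hP : MemLp id 6 P)
    (hs : IsSampleWithSurrogate P μ X Z) (h0 : (k : ℝ≥0∞) ^ 3 * ∫⁻ x, ‖x‖ₑ ^ 6 ∂P = 0) :
    ∀ᵐ ω ∂μ, (fun i => replicateVec k (X i ω)) = fun i => Z i ω := by
  have hzero : ∀ w : Ω → Block k d, AEMeasurable w μ → ∫⁻ ω, ‖w ω‖ₑ ^ 6 ∂μ ≤ 0 →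
      ∀ᵐ ω ∂μ, w ω = 0 := by
    intro w hw h
    rw [nonpos_iff_eq_zero, lintegral_eq_zero_iff' (hw.enorm.pow_const 6)] at h
    filter_upwards [h] with ω hω
    simpa using hω
  have hi : ∀ i : Fin n, ∀ᵐ ω ∂μ, replicateVec k (X i ω) = Z i ω := by
    intro i
    filter_upwards [hzero _ (hs.aemeasurable_replData i)
      (by rw [hs.lintegral_replData, h0]), hzero _ (hs.aemeasurable_gaussian i)
      ((hs.lintegral_gaussian_le hP i).trans (by rw [mul_assoc, h0, mul_zero]))] with ω h1 h2
    rw [h2, ← h1]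
    rfl
  filter_upwards [ae_all_iff.2 hi] with ω hω
  exact funext hω

end Telescope

/-! ### Moment constants and their dependence on `k` -/

section Constants

variable {d k : ℕ} {P : Measure (EuclideanSpace ℝ (Fin d))} [IsProbabilityMeasure P]

lemma ofReal_integral_norm_pow_six {ι : Type*} [Fintype ι] {ν : Measure (EuclideanSpace ℝ ι)}
    [IsFiniteMeasure ν] (hP : MemLp id 6 ν) :
    ENNReal.ofReal (∫ x, ‖x‖ ^ 6 ∂ν) = ∫⁻ x, ‖x‖ₑ ^ 6 ∂ν := by
  have hi : Integrable (fun x => ‖x‖ ^ 6) ν := hP.integrable_norm_pow (p := 6) (by norm_num)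
  rw [ofReal_integral_eq_lintegral_ofReal hi (Eventually.of_forall fun z => by positivity)]
  refine lintegral_congr fun z => ?_
  rw [ENNReal.ofReal_pow (norm_nonneg _), ofReal_norm]

lemma integral_norm_pow_six_surrogate_le (hP : MemLp id 6 P) :
    ∫ z, ‖z‖ ^ 6 ∂(gaussianSurrogate k P) ≤ 15 * k ^ 3 * ∫ x, ‖x‖ ^ 6 ∂P := by
  have h0 : 0 ≤ ∫ x, ‖x‖ ^ 6 ∂P := integral_nonneg fun x => by positivity
  refine (ENNReal.ofReal_le_ofReal_iff (by positivity)).1 ?_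
  rw [ofReal_integral_norm_pow_six (IsGaussian.memLp_id _ 6 (by norm_num)),
    ENNReal.ofReal_mul (by positivity), ofReal_integral_norm_pow_six hP,
    ENNReal.ofReal_mul (by norm_num), ENNReal.ofReal_pow (by positivity), ENNReal.ofReal_natCast]
  simpa using lintegral_enorm_pow_six_surrogate_le (k := k) hP

/-- The root grows at most like `k^{3/2}`, well below `k³`. The bound is uniform in `k`, as needed
when `k` varies with `n`; at `k = 0` the factor `1 / 0` is `0`. -/
lemma surrogate_term_le (hP : MemLp id 6 P) :
    1 / (k : ℝ) ^ 3 * √(∫ z, ‖z‖ ^ 6 ∂(gaussianSurrogate k P))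
      ≤ √(15 * ∫ x, ‖x‖ ^ 6 ∂P) := by
  have h0 : 0 ≤ ∫ x, ‖x‖ ^ 6 ∂P := integral_nonneg fun x => by positivity
  rcases Nat.eq_zero_or_pos k with rfl | hk
  · simp
  have hk1 : (1 : ℝ) ≤ k := by exact_mod_cast hk
  have hk3 : (1 : ℝ) ≤ (k : ℝ) ^ 3 := one_le_pow₀ hk1
  rw [one_div, inv_mul_le_iff₀ (by positivity)]
  refine Real.sqrt_le_iff.2 ⟨by positivity, ?_⟩
  rw [mul_pow, Real.sq_sqrt (by positivity)]
  refine (integral_norm_pow_six_surrogate_le hP).trans ?_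
  have : (k : ℝ) ^ 3 * (∫ x, ‖x‖ ^ 6 ∂P) ≤ ((k : ℝ) ^ 3) ^ 2 * ∫ x, ‖x‖ ^ 6 ∂P := by
    gcongr
    nlinarith
  linarith

lemma rpow_half_moment (hP : MemLp id 6 P) :
    (k ^ 3 * ∫⁻ x, ‖x‖ₑ ^ 6 ∂P) ^ (1 / 2 : ℝ)
      = ENNReal.ofReal ((k : ℝ) ^ (3 / 2 : ℝ)) * ENNReal.ofReal √(∫ x, ‖x‖ ^ 6 ∂P) := by
  have h0 : 0 ≤ ∫ x, ‖x‖ ^ 6 ∂P := integral_nonneg fun x => by positivity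
  rw [ENNReal.mul_rpow_of_nonneg _ _ (by norm_num), ← ofReal_integral_norm_pow_six hP,
    Real.sqrt_eq_rpow, ENNReal.ofReal_rpow_of_nonneg h0 (by norm_num)]
  congr 1
  rw [← ENNReal.ofReal_natCast, ← ENNReal.ofReal_pow (by positivity),
    ENNReal.ofReal_rpow_of_nonneg (by positivity) (by norm_num), ← Real.rpow_natCast,
    ← Real.rpow_mul (by positivity)]
  norm_num

end Constants

/-! ### The bound for arbitrary thrice differentiable test functions -/

section Main

variable {k d n q : ℕ} {P : Measure (EuclideanSpace ℝ (Fin d))} [IsProbabilityMeasure P]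
  {Ω : Type*} [MeasurableSpace Ω] {μ : Measure Ω} [IsProbabilityMeasure μ]
  {X : Fin n → Ω → EuclideanSpace ℝ (Fin d)} {Z : Fin n → Ω → Block k d}
  {f : (Fin n → Block k d) → EuclideanSpace ℝ (Fin q)} {h : EuclideanSpace ℝ (Fin q) → ℝ}

/-- The monomial `(α^1_6)³` alone forces this. -/
lemma lambdaTwo_eq_top (hγ : gammaThree h = ∞) {α : ℕ → ℕ → ℝ≥0∞} (hα : α 1 6 ≠ 0) :
    lambdaTwo h α = ∞ := by
  have : gammaThree h * (α 1 6 ^ 3 + 3 * α 0 6 * α 1 6 * α 2 6 + α 0 6 ^ 2 * α 3 6) = ∞ := by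
    rw [hγ, ENNReal.top_mul]
    simp [hα]
  simp [lambdaTwo, this]

lemma IsSampleWithSurrogate.ofReal_abs_integral_sub_le (hP : MemLp id 6 P)
    (hs : IsSampleWithSurrogate P μ X Z)
    (hf : TimesDifferentiable 3 f) (hh : TimesDifferentiable 3 h)
    (hα : ∀ r < 3, noiseStability μ X Z f r 6 ≠ ∞) :
    ENNReal.ofReal |∫ ω, h (f fun i => replicateVec k (X i ω)) ∂μ - ∫ ω, h (f fun i => Z i ω) ∂μ|
      ≤ ENNReal.ofReal ((n : ℝ) * (k : ℝ) ^ (3 / 2 : ℝ)) * lambdaTwo h (noiseStability μ X Z f)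
        * ENNReal.ofReal (√(∫ x, ‖x‖ ^ 6 ∂P)
            + 1 / (k : ℝ) ^ 3 * √(∫ z, ‖z‖ ^ 6 ∂(gaussianSurrogate k P))) := by
  have hle : ENNReal.ofReal √(∫ x, ‖x‖ ^ 6 ∂P) ≤ ENNReal.ofReal (√(∫ x, ‖x‖ ^ 6 ∂P)
      + 1 / (k : ℝ) ^ 3 * √(∫ z, ‖z‖ ^ 6 ∂(gaussianSurrogate k P))) :=
    ENNReal.ofReal_le_ofReal (le_add_of_nonneg_right (by positivity))
  have hn : ENNReal.ofReal ((n : ℝ) * (k : ℝ) ^ (3 / 2 : ℝ))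
      = n * ENNReal.ofReal ((k : ℝ) ^ (3 / 2 : ℝ)) := by
    rw [ENNReal.ofReal_mul (by positivity), ENNReal.ofReal_natCast]
  have hzero : (∀ᵐ ω ∂μ, h (f fun i => replicateVec k (X i ω)) = h (f fun i => Z i ω)) →
      ENNReal.ofReal |∫ ω, h (f fun i => replicateVec k (X i ω)) ∂μ
        - ∫ ω, h (f fun i => Z i ω) ∂μ| = 0 := by
    intro he
    rw [integral_congr_ae he]
    simp
  -- For infinite `γ³(h)` the right side is infinite unless `α^1_6`, the moment `k³ E‖X‖⁶` or `n`
  -- vanishes. In these cases the two integrands agree almost surely, so the left side is `0` even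
  -- if they are not integrable.
  by_cases hγ : gammaThree h = ∞
  · by_cases h1 : noiseStability μ X Z f 1 6 = 0
    · rw [hzero]
      · exact bot_le
      · filter_upwards [hs.ae_comp_eq_of_noiseStability_one_eq_zero hf h1] with ω hω
        rw [hω]
    · rw [lambdaTwo_eq_top hγ h1]
      by_cases hk : (k : ℝ≥0∞) ^ 3 * ∫⁻ x, ‖x‖ₑ ^ 6 ∂P = 0
      · rw [hzero]
        · exact bot_le
        · filter_upwards [hs.ae_eq_of_moment_eq_zero hP hk] with ω hω
          rw [hω]
      rcases Nat.eq_zero_or_pos n with rfl | hn0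
      · rw [hzero]
        · exact bot_le
        · refine Eventually.of_forall fun ω => ?_
          congr 2
          exact Subsingleton.elim _ _
      have hpos : ENNReal.ofReal ((k : ℝ) ^ (3 / 2 : ℝ)) * ENNReal.ofReal √(∫ x, ‖x‖ ^ 6 ∂P) ≠ 0 := by
        rw [← rpow_half_moment hP]
        simpa using hk
      have hk0 := left_ne_zero_of_mul hpos
      have hM0 := right_ne_zero_of_mul hpos
      rw [hn, ENNReal.mul_top (mul_ne_zero (by exact_mod_cast hn0.ne') hk0),
        ENNReal.top_mul (ne_of_gt (lt_of_lt_of_le (pos_iff_ne_zero.2 hM0) hle))]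
      exact le_top
  · have := hs.enorm_integral_sub_le hP hf hh hγ hα
    rw [← Real.enorm_eq_ofReal_abs]
    refine this.trans ?_
    rw [rpow_half_moment hP, hn]
    calc _ = n * ENNReal.ofReal ((k : ℝ) ^ (3 / 2 : ℝ)) * lambdaTwo h (noiseStability μ X Z f)
          * ENNReal.ofReal √(∫ x, ‖x‖ ^ 6 ∂P) := by ring
      _ ≤ _ := by gcongr

end Main

end

theorem mainTheorem6 {d q : ℕ} (P : Measure (EuclideanSpace ℝ (Fin d))) [IsProbabilityMeasure P]
    (hP : Integrable (fun x => ‖x‖ ^ 6) P) :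
    (∀ (n k : ℕ) (Ω : Type*) [MeasurableSpace Ω] (μ : Measure Ω) [IsProbabilityMeasure μ]
      (X : Fin n → Ω → EuclideanSpace ℝ (Fin d)) (Z : Fin n → Ω → Block k d),
      IsSampleWithSurrogate P μ X Z →
      ∀ (f : (Fin n → Block k d) → EuclideanSpace ℝ (Fin q)) (h : EuclideanSpace ℝ (Fin q) → ℝ),
        TimesDifferentiable 3 f → TimesDifferentiable 3 h →
        (∀ r < 3, noiseStability μ X Z f r 6 ≠ ∞) →
        (gammaThree h ≠ ∞ →
          Integrable (fun ω => h (f fun i => replicateVec k (X i ω))) μ ∧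
          Integrable (fun ω => h (f fun i => Z i ω)) μ) ∧
        ENNReal.ofReal |∫ ω, h (f fun i => replicateVec k (X i ω)) ∂μ
            - ∫ ω, h (f fun i => Z i ω) ∂μ|
          ≤ ENNReal.ofReal ((n : ℝ) * (k : ℝ) ^ (3 / 2 : ℝ))
            * lambdaTwo h (noiseStability μ X Z f)
            * ENNReal.ofReal (√(∫ x, ‖x‖ ^ 6 ∂P)
                + 1 / (k : ℝ) ^ 3 * √(∫ z, ‖z‖ ^ 6 ∂(gaussianSurrogate k P)))) ∧
    (fun k : ℕ => 1 / (k : ℝ) ^ 3 * √(∫ z, ‖z‖ ^ 6 ∂(gaussianSurrogate k P)))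
      =O[atTop] (fun _ => (1 : ℝ)) ∧
    (∀ (k : ℕ → ℕ) (Ω : ℕ → Type*) [∀ n, MeasurableSpace (Ω n)] (μ : ∀ n, Measure (Ω n))
      [∀ n, IsProbabilityMeasure (μ n)]
      (X : ∀ n, Fin n → Ω n → EuclideanSpace ℝ (Fin d)) (Z : ∀ n, Fin n → Ω n → Block (k n) d),
      (∀ n, IsSampleWithSurrogate P (μ n) (X n) (Z n)) →
      ∀ f : ∀ n, (Fin n → Block (k n) d) → EuclideanSpace ℝ (Fin q),
        (∀ n, TimesDifferentiable 3 (f n)) →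
        (∀ᶠ n in atTop, ∀ r < 3, noiseStability (μ n) (X n) (Z n) (f n) r 6 ≠ ∞) →
        SmoothnessLambdaTwo k (fun n => noiseStability (μ n) (X n) (Z n) (f n)) →
        Tendsto (fun n => dH (μ n) (fun ω => f n fun i => replicateVec (k n) (X n i ω))
          (fun ω => f n fun i => Z n i ω)) atTop (𝓝 0)) := by
  have hP6 := memLp_six_of_integrable hP
  refine ⟨?_, ?_, ?_⟩
  · intro n k Ω _ μ _ X Z hs f h hf hh hα
    refine ⟨fun hγ => ⟨?_, ?_⟩, hs.ofReal_abs_integral_sub_le hP6 hf hh hα⟩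
    · have := hs.integrable_mixedSample hP6 hf hh hγ hα le_rfl
      simpa only [mixedSample_all] using this
    · have := hs.integrable_mixedSample hP6 hf hh hγ hα (Nat.zero_le n)
      simpa only [mixedSample_zero] using this
  · refine Asymptotics.IsBigO.of_bound √(15 * ∫ x, ‖x‖ ^ 6 ∂P) (Eventually.of_forall fun k => ?_)
    rw [Real.norm_of_nonneg (by positivity), norm_one, mul_one]
    exact surrogate_term_le hP6
  · intro k Ω _ μ _ X Z hs f hf hfin hsm
    set α := fun n => noiseStability (μ n) (X n) (Z n) (f n) with hα
    obtain ⟨t1, t2, t3, t4, t5, t6⟩ := hsm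
    set c := fun n : ℕ => ENNReal.ofReal ((n : ℝ) * (k n : ℝ) ^ (3 / 2 : ℝ)) with hc
    -- A bound for the moment factor that does not depend on `k n`.
    set K := ENNReal.ofReal (√(∫ x, ‖x‖ ^ 6 ∂P) + √(15 * ∫ x, ‖x‖ ^ 6 ∂P)) with hK
    have hlim : Tendsto (fun n => (c n * α n 1 6 ^ 3 + 3 * (c n * (α n 0 6 * α n 1 6 * α n 2 6))
        + c n * (α n 0 6 ^ 2 * α n 3 6) + 3 * (c n * (α n 1 4 * α n 2 4))
        + c n * (α n 0 4 * α n 3 4) + c n * α n 3 2) * K) atTop (𝓝 0) := by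
      have h3 : ∀ {u : ℕ → ℝ≥0∞}, Tendsto u atTop (𝓝 0) →
          Tendsto (fun n => 3 * u n) atTop (𝓝 0) := fun hu => by
        simpa using ENNReal.Tendsto.const_mul hu (Or.inr (by norm_num : (3 : ℝ≥0∞) ≠ ∞))
      have := ((((t1.add (h3 t2)).add t3).add (h3 t4)).add t5).add t6
      have := ENNReal.Tendsto.mul_const this (b := K) (Or.inr ENNReal.ofReal_ne_top)
      simp only [add_zero, zero_mul] at this
      exact this
    refine tendsto_of_tendsto_of_tendsto_of_le_of_le' tendsto_const_nhds hlim
      (Eventually.of_forall fun n => bot_le) ?_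
    filter_upwards [hfin] with n hn
    refine iSup₂_le fun h hh => ?_
    obtain ⟨hd, he1, he2, hg⟩ := hh
    refine ((hs n).ofReal_abs_integral_sub_le hP6 (hf n) hd hn).trans ?_
    gcongr
    -- On the test class `γ³`, `η²`, `η¹` are at most `1`, so this bound is uniform in `h` and
    -- passes to the supremum.
    · calc c n * lambdaTwo h (α n)
          ≤ c n * (1 * (α n 1 6 ^ 3 + 3 * α n 0 6 * α n 1 6 * α n 2 6 + α n 0 6 ^ 2 * α n 3 6)
            + 1 * (3 * α n 1 4 * α n 2 4 + α n 0 4 * α n 3 4) + 1 * α n 3 2) := by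
            unfold lambdaTwo
            gcongr
        _ = _ := by ring
    · rw [hK]
      gcongr
      exact surrogate_term_le hP6
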